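/- Let $(\mathcal C,\otimes,I,\psi)$ be a symmetric monoidal category whose underlying category is abelian. Associativity and unit isomorphisms are suppressed, $1$ denotes identities, $(f,g)$ denotes $f\otimes g$, $A^n$ denotes $A^{\otimes n}$, and composition is written right to left. Let $(H,m,\eta,\Delta,\varepsilon,S)$ be a Hopf algebra in $\mathcal C$. Let $(C,\Delta_C,\varepsilon_C,\phi_C)$ be a left $H$-module coalgebra in $\mathcal C$: a coalgebra with a left $H$-module structure $\phi_C:H\otimes C\to C$ such that $\Delta_C\phi_C=(\phi_C,\phi_C)(1_H,\psi_{H,C},1_C)(\Delta,\Delta_C)$ and $\varepsilon_C\phi_C=\varepsilon\otimes\varepsilon_C$. Let $M$ be a right-left braided stable anti-Yetter–Drinfeld $H$-module: a right $H$-module $\phi_M:M\otimes H\to M$ and left $H$-comodule $\rho_M:M\to H\otimes M$ such that $$\rho_M\phi_M=\big(m(S,m),\phi_M\big)(\psi_{H^2,H},1_M,1_H)(1_{H^2},\psi_{M,H},1_H)(1_{H^2},1_M,\psi_{H,H})(1_H,\psi_{M,H},1_{H^2})\big(\rho_M,(1_H,\Delta)\Delta\big)$$ and $\phi_M\psi_{H,M}\rho_M=1_M$.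 For $n\ge 0$ put $C^n(C,M)=M\otimes C^{n+1}$, and define faces $\delta_i:C^{n-1}(C,M)\to C^n(C,M)$ ($n\ge1$, $0\le i\le n$), degeneracies $\sigma_i:C^{n+1}(C,M)\to C^n(C,M)$ ($0\le i\le n$) and cyclic maps $\tau_n:C^n(C,M)\to C^n(C,M)$ by $$\delta_i=(1_M,1_{C^i},\Delta_C,1_{C^{n-i-1}})\ \ (0\le i<n),\qquad \delta_n=(1_M,\psi_{C,C^n})(1_M,\phi_C,1_{C^n})(\psi_{H,M},1_{C^{n+1}})(\rho_M,\Delta_C,1_{C^{n-1}}),$$ $$\sigma_i=(1_M,1_{C^{i+1}},\varepsilon_C,1_{C^{n-i}}),\qquad \tau_n=(1_M,\psi_{C,C^n})(1_M,\phi_C,1_{C^n})(\psi_{H,M},1_{C^{n+1}})(\rho_M,1_{C^{n+1}}).$$ Let $H$ act on $C^{n+1}$ by the diagonal action $\phi_{C^{n+1}}:H\otimes C^{n+1}\to C^{n+1}$, obtained by applying the iterated comultiplication $H\to H^{n+1}$, then shuffling $H^{n+1}\otimes C^{n+1}\to(H\otimes C)^{n+1}$ by means of $\psi_{H,C}$,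 then applying $\phi_C$ in each factor. Let $$C^n_H(C,M)=M\otimes_H C^{n+1}=\operatorname{coker}\big(\phi_M\otimes 1_{C^{n+1}}-1_M\otimes\phi_{C^{n+1}}:M\otimes H\otimes C^{n+1}\to M\otimes C^{n+1}\big).$$ Then all the maps $\delta_i,\sigma_i,\tau_n$ descend to unique maps $\widetilde\delta_i,\widetilde\sigma_i,\widetilde\tau_n$ between the objects $C^n_H(C,M)$, commuting with the quotient maps $M\otimes C^{n+1}\to M\otimes_HC^{n+1}$, and $(C^\bullet_H(C,M),\widetilde\delta_i,\widetilde\sigma_i,\widetilde\tau_n)$ is a cocyclic object in $\mathcal C$. That is, the cosimplicial identities $$\widetilde\delta_j\widetilde\delta_i=\widetilde\delta_i\widetilde\delta_{j-1}\ (i<j),\quad \widetilde\sigma_j\widetilde\sigma_i=\widetilde\sigma_i\widetilde\sigma_{j+1}\ (i\le j),\quad \widetilde\sigma_j\widetilde\delta_i=\begin{cases}\widetilde\delta_i\widetilde\sigma_{j-1}& i<j\\ \mathrm{id}& i=j,\,j+1\\ \widetilde\delta_{i-1}\widetilde\sigma_j& i>j+1\end{cases}$$ hold, together with the cyclic relations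 $$\widetilde\tau_n\widetilde\delta_i=\widetilde\delta_{i-1}\widetilde\tau_{n-1}\ (1\le i\le n),\qquad \widetilde\tau_n\widetilde\delta_0=\widetilde\delta_n,$$ $$\widetilde\tau_n\widetilde\sigma_i=\widetilde\sigma_{i-1}\widetilde\tau_{n+1}\ (1\le i\le n),\qquad \widetilde\tau_n\widetilde\sigma_0=\widetilde\sigma_n\widetilde\tau_{n+1}^2,\qquad \widetilde\tau_n^{\,n+1}=\mathrm{id}.$$ -/

import Mathlib

open CategoryTheory MonoidalCategory Limits
open scoped MonObj ComonObj HopfObj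

universe v u

noncomputable section

namespace BraidedHopfCyclic

/-! ### Cocyclic objects -/

section Cocyclic

variable {𝒞 : Type u} [Category.{v} 𝒞]

/-- Candidate cofaces `δ_i : X n ⟶ X (n+1)` for `0 ≤ i ≤ n+1`, codegeneracies
`σ_i : X (n+1) ⟶ X n` for `0 ≤ i ≤ n`, and cyclic maps `τ_n : X n ⟶ X n`
on a sequence of objects (no relations imposed). -/
@[ext]
structure CocyclicOperators (X : ℕ → 𝒞) where
  δ : ∀ n : ℕ, Fin (n + 2) → (X n ⟶ X (n + 1))
  σ : ∀ n : ℕ, Fin (n + 1) → (X (n + 1) ⟶ X n)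
  τ : ∀ n : ℕ, X n ⟶ X n

/-- The operators make `X` a cocyclic object: the cosimplicial identities, the compatibility
of the cyclic maps with cofaces and codegeneracies, and `τ_n ^ (n + 1) = id`. -/
structure CocyclicOperators.IsCocyclic {X : ℕ → 𝒞} (D : CocyclicOperators X) : Prop where
  δ_comp_δ : ∀ (n : ℕ) (i j : Fin (n + 2)), i ≤ j →
    D.δ n i ≫ D.δ (n + 1) j.succ = D.δ n j ≫ D.δ (n + 1) i.castSucc
  σ_comp_σ : ∀ (n : ℕ) (i j : Fin (n + 1)), i ≤ j →
    D.σ (n + 1) i.castSucc ≫ D.σ n j = D.σ (n + 1) j.succ ≫ D.σ n i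
  δ_comp_σ_of_le : ∀ (n : ℕ) (i : Fin (n + 2)) (j : Fin (n + 1)), i ≤ j.castSucc →
    D.δ (n + 1) i.castSucc ≫ D.σ (n + 1) j.succ = D.σ n j ≫ D.δ n i
  δ_comp_σ_self : ∀ (n : ℕ) (i : Fin (n + 1)), D.δ n i.castSucc ≫ D.σ n i = 𝟙 (X n)
  δ_comp_σ_succ : ∀ (n : ℕ) (i : Fin (n + 1)), D.δ n i.succ ≫ D.σ n i = 𝟙 (X n)
  δ_comp_σ_of_gt : ∀ (n : ℕ) (i : Fin (n + 2)) (j : Fin (n + 1)), j.castSucc < i →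
    D.δ (n + 1) i.succ ≫ D.σ (n + 1) j.castSucc = D.σ n j ≫ D.δ n i
  δ_zero_comp_τ : ∀ n : ℕ, D.δ n 0 ≫ D.τ (n + 1) = D.δ n (Fin.last (n + 1))
  δ_succ_comp_τ : ∀ (n : ℕ) (i : Fin (n + 1)),
    D.δ n i.succ ≫ D.τ (n + 1) = D.τ n ≫ D.δ n i.castSucc
  σ_zero_comp_τ : ∀ n : ℕ,
    D.σ n 0 ≫ D.τ n = D.τ (n + 1) ≫ D.τ (n + 1) ≫ D.σ n (Fin.last n)
  σ_succ_comp_τ : ∀ (n : ℕ) (i : Fin n),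
    D.σ n i.succ ≫ D.τ n = D.τ (n + 1) ≫ D.σ n i.castSucc
  τ_pow : ∀ n : ℕ, (End.of (D.τ n)) ^ (n + 1) = 1

end Cocyclic

/-! ### Modules, comodules and module coalgebras -/

section Structures

variable {𝒞 : Type u} [Category.{v} 𝒞] [MonoidalCategory 𝒞]

/-- A right module over a monoid object. -/
class RightModObj (H : 𝒞) [MonObj H] (M : 𝒞) where
  act : M ⊗ H ⟶ M
  act_one : M ◁ η[H] ≫ act = (ρ_ M).hom
  act_mul : M ◁ μ[H] ≫ act = (α_ M H H).inv ≫ act ▷ H ≫ act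

/-- A left comodule over a comonoid object. -/
class LeftComodObj (H : 𝒞) [ComonObj H] (M : 𝒞) where
  coact : M ⟶ H ⊗ M
  counit_coact : coact ≫ ε[H] ▷ M = (λ_ M).inv
  comul_coact : coact ≫ Δ[H] ▷ M = coact ≫ H ◁ coact ≫ (α_ H H M).inv

variable [BraidedCategory 𝒞]

/-- A left `H`-module coalgebra: a comonoid object with a left `H`-action that is a
morphism of coalgebras. -/
class ModuleCoalgObj (H : 𝒞) [HopfObj H] (C : 𝒞) extends ComonObj C, ModObj H C where
  smul_comul : (γ[H, C] : H ⊗ C ⟶ C) ≫ Δ[C] =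
    (Δ[H] ⊗ₘ Δ[C]) ≫ tensorμ H H C C ≫ ((γ[H, C] : H ⊗ C ⟶ C) ⊗ₘ (γ[H, C] : H ⊗ C ⟶ C))
  smul_counit : (γ[H, C] : H ⊗ C ⟶ C) ≫ ε[C] = (ε[H] ⊗ₘ ε[C]) ≫ (λ_ (𝟙_ 𝒞)).hom

/-- A right-left braided stable anti-Yetter–Drinfeld module over `H`.  In Sweedler notation
(with the symmetries suppressed) the two axioms read
`(m h)₍₋₁₎ ⊗ (m h)₍₀₎ = S(h⁽³⁾) (m₍₋₁₎ h⁽¹⁾) ⊗ m₍₀₎ h⁽²⁾` and `m₍₀₎ m₍₋₁₎ = m`. -/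
class SAYDObj (H : 𝒞) [HopfObj H] (M : 𝒞) extends RightModObj H M, LeftComodObj H M where
  anti_yetter_drinfeld :
    act ≫ coact =
      (coact ⊗ₘ (Δ[H] ≫ H ◁ Δ[H])) ⊗≫
        H ◁ (β_ M H).hom ▷ (H ⊗ H) ⊗≫
        (H ⊗ H ⊗ M) ◁ (β_ H H).hom ⊗≫
        (H ⊗ H) ◁ (β_ M H).hom ▷ H ⊗≫
        (β_ (H ⊗ H) H).hom ▷ (M ⊗ H) ⊗≫
        (((𝒮[H] ⊗ₘ μ[H]) ≫ μ[H]) ⊗ₘ act)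
  stable : coact ≫ (β_ H M).hom ≫ act = 𝟙 M

end Structures

/-! ### Tensor powers -/

section TensorPowers

variable {𝒞 : Type u} [Category.{v} 𝒞] [MonoidalCategory 𝒞]

/-- The tensor power `A ^ n = A ⊗ (A ⊗ (⋯ ⊗ (A ⊗ 𝟙_)))`. -/
def tpow (A : 𝒞) : ℕ → 𝒞
  | 0 => 𝟙_ 𝒞
  | n + 1 => A ⊗ tpow A n

/-- The tensor power `f ^ n : A ^ n ⟶ B ^ n` of a morphism. -/
def tpowMap {A B : 𝒞} (f : A ⟶ B) : ∀ n : ℕ, tpow A n ⟶ tpow B n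
  | 0 => 𝟙 (𝟙_ 𝒞)
  | n + 1 => f ⊗ₘ tpowMap f n

/-- The coherence isomorphism `A ^ n ⊗ A ≅ A ^ (n + 1)`. -/
def tpowSnoc (A : 𝒞) : ∀ n : ℕ, tpow A n ⊗ A ≅ tpow A (n + 1)
  | 0 => λ_ A ≪≫ (ρ_ A).symm
  | n + 1 => α_ A (tpow A n) A ≪≫ whiskerLeftIso A (tpowSnoc A n)

/-- `1_{C^i} ⊗ Δ_C ⊗ 1_{C^{n-i-1}} : C ^ n ⟶ C ^ (n + 1)`, comultiplying the `i`-th factor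
(factors numbered from `0`). -/
def comulAt (C : 𝒞) [ComonObj C] : ∀ n : ℕ, Fin n → (tpow C n ⟶ tpow C (n + 1))
  | 0 => fun i => i.elim0
  | n + 1 => Fin.cases (Δ[C] ▷ tpow C n ≫ (α_ C C (tpow C n)).hom)
      (fun i => C ◁ comulAt C n i)

/-- `1_{C^i} ⊗ ε_C ⊗ 1_{C^{n-i}} : C ^ (n + 1) ⟶ C ^ n`, applying the counit to the `i`-th
factor (factors numbered from `0`). -/
def counitAt (C : 𝒞) [ComonObj C] : ∀ n : ℕ, Fin (n + 1) → (tpow C (n + 1) ⟶ tpow C n)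
  | 0 => fun _ => ε[C] ▷ 𝟙_ 𝒞 ≫ (λ_ (𝟙_ 𝒞)).hom
  | n + 1 => Fin.cases (ε[C] ▷ tpow C (n + 1) ≫ (λ_ (tpow C (n + 1))).hom)
      (fun i => C ◁ counitAt C n i)

/-- The iterated comultiplication `H ⟶ H ^ n`; it is the counit for `n = 0` and, up to the
unit isomorphism `H ≅ H ⊗ 𝟙_`, the identity for `n = 1`. -/
def iterComul (H : 𝒞) [ComonObj H] : ∀ n : ℕ, H ⟶ tpow H n
  | 0 => ε[H]
  | n + 1 => Δ[H] ≫ H ◁ iterComul H n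

variable [BraidedCategory 𝒞]

/-- The shuffle `A ^ n ⊗ B ^ n ⟶ (A ⊗ B) ^ n`, built from the braidings `β_ A B`, that keeps
the order of the `A`s and the order of the `B`s. -/
def tpowShuffle (A B : 𝒞) : ∀ n : ℕ, tpow A n ⊗ tpow B n ⟶ tpow (A ⊗ B) n
  | 0 => (λ_ (𝟙_ 𝒞)).hom
  | n + 1 => tensorμ A (tpow A n) B (tpow B n) ≫ (A ⊗ B) ◁ tpowShuffle A B n

/-- The diagonal action `H ⊗ C ^ n ⟶ C ^ n`. -/
def diagAct (H C : 𝒞) [HopfObj H] [ModObj H C] (n : ℕ) : H ⊗ tpow C n ⟶ tpow C n :=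
  iterComul H n ▷ tpow C n ≫ tpowShuffle H C n ≫ tpowMap (γ[H, C] : H ⊗ C ⟶ C) n

end TensorPowers

/-! ### The operators on `M ⊗ C ^ (n + 1)` -/

section Operators

variable {𝒞 : Type u} [Category.{v} 𝒞] [MonoidalCategory 𝒞] [BraidedCategory 𝒞]
variable (H C M : 𝒞) [HopfObj H] [ModuleCoalgObj H C] [SAYDObj H M]

/-- The composite `(1_M, ψ_{C,C^n}) (1_M, φ_C, 1_{C^n}) (ψ_{H,M}, 1_{C^{n+1}})`. -/
def twist (n : ℕ) : (H ⊗ M) ⊗ tpow C (n + 1) ⟶ M ⊗ tpow C (n + 1) :=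
  (β_ H M).hom ▷ (C ⊗ tpow C n) ≫
    (α_ M H (C ⊗ tpow C n)).hom ≫
    M ◁ ((α_ H C (tpow C n)).inv ≫
      (γ[H, C] : H ⊗ C ⟶ C) ▷ tpow C n ≫
      (β_ C (tpow C n)).hom ≫
      (tpowSnoc C n).hom)

/-- The faces, degeneracies and cyclic maps on `C^n(C, M) = M ⊗ C ^ (n + 1)`. -/
def operators : CocyclicOperators (fun n : ℕ => M ⊗ tpow C (n + 1)) where
  δ n := Fin.lastCases
    (((LeftComodObj.coact : M ⟶ H ⊗ M) ⊗ₘ comulAt C (n + 1) 0) ≫ twist H C M (n + 1))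
    (fun i : Fin (n + 1) => M ◁ comulAt C (n + 1) i)
  σ n i := M ◁ counitAt C (n + 1) i.succ
  τ n := (LeftComodObj.coact : M ⟶ H ⊗ M) ▷ tpow C (n + 1) ≫ twist H C M n

end Operators

/-! ### Balanced tensor products -/

section Balanced

variable {𝒞 : Type u} [Category.{v} 𝒞] [MonoidalCategory 𝒞] [Abelian 𝒞]

/-- The map `φ_V ⊗ 1_W - 1_V ⊗ φ_W : V ⊗ H ⊗ W ⟶ V ⊗ W`. -/
def balancingMap {H V W : 𝒞} (φV : V ⊗ H ⟶ V) (φW : H ⊗ W ⟶ W) : (V ⊗ H) ⊗ W ⟶ V ⊗ W :=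
  φV ▷ W - (α_ V H W).hom ≫ V ◁ φW

variable [BraidedCategory 𝒞]
variable (H C M : 𝒞) [HopfObj H] [ModuleCoalgObj H C] [SAYDObj H M]

/-- `C^n_H(C, M) = M ⊗_H C ^ (n + 1)`. -/
def balanced (n : ℕ) : 𝒞 :=
  cokernel (balancingMap (RightModObj.act : M ⊗ H ⟶ M) (diagAct H C (n + 1)))

/-- The quotient map `M ⊗ C ^ (n + 1) ⟶ M ⊗_H C ^ (n + 1)`. -/
def balancedπ (n : ℕ) : M ⊗ tpow C (n + 1) ⟶ balanced H C M n :=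
  cokernel.π (balancingMap (RightModObj.act : M ⊗ H ⟶ M) (diagAct H C (n + 1)))

/-- The operators `D` on the balanced tensor products are induced by those on
`M ⊗ C ^ (n + 1)`. -/
structure IsInduced (D : CocyclicOperators (balanced H C M)) : Prop where
  δ : ∀ (n : ℕ) (i : Fin (n + 2)),
    balancedπ H C M n ≫ D.δ n i = (operators H C M).δ n i ≫ balancedπ H C M (n + 1)
  σ : ∀ (n : ℕ) (i : Fin (n + 1)),
    balancedπ H C M (n + 1) ≫ D.σ n i = (operators H C M).σ n i ≫ balancedπ H C M n
  τ : ∀ n : ℕ, balancedπ H C M n ≫ D.τ n = (operators H C M).τ n ≫ balancedπ H C M n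

end Balanced

end BraidedHopfCyclic

end

/-! A left comodule M has a half-braiding m ⊗ v ↦ m₍₋₁₎v ⊗ m₍₀₎ with any object V carrying an
H-action. It is natural in equivariant maps, and the comodule axioms make it compatible with the
trivial action on the unit and with diagonal actions (`halfBraiding_tensorAct`). Followed by a
symmetry it becomes `rotate`, and τ_n is the rotation of one factor C past the remaining n. Rotating
a block V ⊗ W amounts to rotating V and then W (`rotate_tensorAct`). Hence the relations between τ
and the cofaces and codegeneracies reduce to naturality and the H-linearity of Δ_C and ε_C, and
τ_n^k rotates a block of k factors (`tpowAppend_comp_cyclicMap_pow`).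

These relations hold already on M ⊗ C^{n+1}, with one exception: there τ_n^{n+1} is m ⊗ w ↦ m₍₀₎ ⊗
m₍₋₁₎w (`cyclicMap_pow`). Over H this equals m₍₀₎m₍₋₁₎ ⊗ w, which is m ⊗ w by stability
(`Balances.coactAct_comp`).

The inner cofaces and the codegeneracies descend because they are H-linear in the second factor. For
τ the anti-Yetter–Drinfeld condition sends mh ⊗ v ⊗ x to m₍₀₎h⁽²⁾ ⊗ x ⊗ S(h⁽³⁾)m₍₋₁₎h⁽¹⁾v. Moving
h⁽²⁾ across ⊗_H creates a product h⁽³⁾S(h⁽⁴⁾), which cancels, and what remains is the rotation of m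
⊗ h⁽¹⁾v ⊗ h⁽²⁾x (`Balances.rotate`). The last coface is δ_0 followed by τ, so it descends too, and
its relations are formal (`CocyclicOperators.IsCocyclic.of_inner`). -/

noncomputable section

namespace BraidedHopfCyclic

open BraidedCategory

/-! ### Equivariant maps and diagonal actions -/

section Intertwiners

variable {𝒞 : Type u} [Category.{v} 𝒞] [MonoidalCategory 𝒞] {H : 𝒞}

/-- `f` intertwines the action maps `φ` and `χ`. -/
def Intertwines {V W : 𝒞} (φ : H ⊗ V ⟶ V) (χ : H ⊗ W ⟶ W) (f : V ⟶ W) : Prop :=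
  φ ≫ f = H ◁ f ≫ χ

theorem Intertwines.id {V : 𝒞} (φ : H ⊗ V ⟶ V) : Intertwines φ φ (𝟙 V) := by
  simp [Intertwines]

theorem Intertwines.comp {U V W : 𝒞} {φ : H ⊗ U ⟶ U} {χ : H ⊗ V ⟶ V} {ω : H ⊗ W ⟶ W}
    {f : U ⟶ V} {g : V ⟶ W} (hf : Intertwines φ χ f) (hg : Intertwines χ ω g) :
    Intertwines φ ω (f ≫ g) := by
  unfold Intertwines at *
  rw [reassoc_of% hf, hg, whiskerLeft_comp, Category.assoc]

theorem Intertwines.iso_inv {V W : 𝒞} {φ : H ⊗ V ⟶ V} {χ : H ⊗ W ⟶ W} (e : V ≅ W)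
    (he : Intertwines φ χ e.hom) : Intertwines χ φ e.inv := by
  unfold Intertwines at *
  rw [← cancel_epi (H ◁ e.hom), ← reassoc_of% he]
  simp

end Intertwiners

section ActionMaps

variable {𝒞 : Type u} [Category.{v} 𝒞] [MonoidalCategory 𝒞] [BraidedCategory 𝒞]
variable {H : 𝒞} [ComonObj H]

/-- The diagonal action on a tensor product of two objects with `H`-actions. -/
def tensorAct {V W : 𝒞} (φ : H ⊗ V ⟶ V) (χ : H ⊗ W ⟶ W) : H ⊗ (V ⊗ W) ⟶ V ⊗ W :=
  Δ[H] ▷ (V ⊗ W) ≫ tensorμ H H V W ≫ (φ ⊗ₘ χ)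

variable (H) in
/-- The trivial action on the unit object. -/
def unitAct : H ⊗ 𝟙_ 𝒞 ⟶ 𝟙_ 𝒞 := ε[H] ▷ 𝟙_ 𝒞 ≫ (λ_ (𝟙_ 𝒞)).hom

theorem Intertwines.tensorHom {V V' W W' : 𝒞} {φ : H ⊗ V ⟶ V} {φ' : H ⊗ V' ⟶ V'}
    {χ : H ⊗ W ⟶ W} {χ' : H ⊗ W' ⟶ W'} {f : V ⟶ V'} {g : W ⟶ W'}
    (hf : Intertwines φ φ' f) (hg : Intertwines χ χ' g) :
    Intertwines (tensorAct φ χ) (tensorAct φ' χ') (f ⊗ₘ g) := by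
  unfold Intertwines tensorAct at *
  rw [whisker_exchange_assoc, tensorμ_natural_right_assoc]
  simp only [Category.assoc, tensorHom_comp_tensorHom, hf, hg]

theorem Intertwines.whiskerLeft {V W W' : 𝒞} (φ : H ⊗ V ⟶ V)
    {χ : H ⊗ W ⟶ W} {χ' : H ⊗ W' ⟶ W'} {g : W ⟶ W'} (hg : Intertwines χ χ' g) :
    Intertwines (tensorAct φ χ) (tensorAct φ χ') (V ◁ g) := by
  rw [← id_tensorHom]
  exact (Intertwines.id φ).tensorHom hg

theorem Intertwines.whiskerRight {V V' W : 𝒞} {φ : H ⊗ V ⟶ V} {φ' : H ⊗ V' ⟶ V'}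
    {f : V ⟶ V'} (hf : Intertwines φ φ' f) (χ : H ⊗ W ⟶ W) :
    Intertwines (tensorAct φ χ) (tensorAct φ' χ) (f ▷ W) := by
  rw [← tensorHom_id]
  exact hf.tensorHom (Intertwines.id χ)

/-- Coassociativity of Δ combined with the coherence of `tensorμ` with associators; the maps φ, χ, ω
need not satisfy any module axiom. -/
theorem intertwines_associator {U V W : 𝒞} (φ : H ⊗ U ⟶ U) (χ : H ⊗ V ⟶ V) (ω : H ⊗ W ⟶ W) :
    Intertwines (tensorAct (tensorAct φ χ) ω) (tensorAct φ (tensorAct χ ω)) (α_ U V W).hom := by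
  unfold Intertwines tensorAct
  have h := associator_monoidal H H H U V W
  have h₁ := tensorμ_natural_left Δ[H] (𝟙 H) (U ⊗ V) W
  have h₂ := tensorμ_natural_left (𝟙 H) Δ[H] U (V ⊗ W)
  simp only [id_tensorHom, tensorHom_id, id_whiskerRight] at h₁ h₂
  have h₃ := ComonObj.comul_assoc H
  calc
    _ = (Δ[H] ≫ Δ[H] ▷ H) ▷ ((U ⊗ V) ⊗ W) ≫ (tensorμ (H ⊗ H) H (U ⊗ V) W ≫
          tensorμ H H U V ▷ (H ⊗ W) ≫ (α_ (H ⊗ U) (H ⊗ V) (H ⊗ W)).hom) ≫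
          (φ ⊗ₘ (χ ⊗ₘ ω)) := by
      simp only [comp_whiskerRight, Category.assoc, reassoc_of% h₁]
      rw [← associator_naturality]
      simp only [← tensorHom_id, tensorHom_comp_tensorHom_assoc, Category.id_comp]
    _ = _ := by
      rw [h]
      have h₄ : (Δ[H] ≫ Δ[H] ▷ H) ▷ ((U ⊗ V) ⊗ W) ≫ ((α_ H H H).hom ⊗ₘ (α_ U V W).hom) =
          H ◁ (α_ U V W).hom ≫ (Δ[H] ≫ H ◁ Δ[H]) ▷ (U ⊗ V ⊗ W) := by
        rw [h₃, MonoidalCategory.tensorHom_def', ← whisker_exchange_assoc, ← comp_whiskerRight]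
        simp only [Category.assoc]
      rw [Category.assoc, reassoc_of% h₄]
      simp only [comp_whiskerRight, Category.assoc, reassoc_of% h₂]
      simp only [← id_tensorHom, tensorHom_comp_tensorHom, Category.id_comp]

theorem intertwines_leftUnitor {V : 𝒞} (φ : H ⊗ V ⟶ V) :
    Intertwines (tensorAct (unitAct H) φ) φ (λ_ V).hom := by
  unfold Intertwines tensorAct unitAct
  have h := leftUnitor_monoidal H V
  have h₁ := tensorμ_natural_left ε[H] (𝟙 H) (𝟙_ 𝒞) V
  simp only [tensorHom_id, id_whiskerRight] at h₁
  calc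
    _ = Δ[H] ▷ (𝟙_ 𝒞 ⊗ V) ≫ ε[H] ▷ H ▷ (𝟙_ 𝒞 ⊗ V) ≫ (tensorμ (𝟙_ 𝒞) H (𝟙_ 𝒞) V ≫
        (λ_ (𝟙_ 𝒞)).hom ▷ (H ⊗ V) ≫ (λ_ (H ⊗ V)).hom) ≫ φ := by
      simp only [Category.assoc, reassoc_of% h₁]
      rw [← leftUnitor_naturality]
      simp only [← tensorHom_id, ← id_tensorHom, tensorHom_comp_tensorHom_assoc, Category.id_comp,
        Category.comp_id]
    _ = _ := by
      rw [← h, ← comp_whiskerRight_assoc, ComonObj.counit_comul, MonoidalCategory.tensorHom_def]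
      simp

theorem intertwines_rightUnitor {V : 𝒞} (φ : H ⊗ V ⟶ V) :
    Intertwines (tensorAct φ (unitAct H)) φ (ρ_ V).hom := by
  unfold Intertwines tensorAct unitAct
  have h := rightUnitor_monoidal H V
  have h₁ := tensorμ_natural_left (𝟙 H) ε[H] V (𝟙_ 𝒞)
  simp only [id_tensorHom, id_whiskerRight] at h₁
  calc
    _ = Δ[H] ▷ (V ⊗ 𝟙_ 𝒞) ≫ (H ◁ ε[H]) ▷ (V ⊗ 𝟙_ 𝒞) ≫ (tensorμ H (𝟙_ 𝒞) V (𝟙_ 𝒞) ≫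
        (H ⊗ V) ◁ (λ_ (𝟙_ 𝒞)).hom ≫ (ρ_ (H ⊗ V)).hom) ≫ φ := by
      simp only [Category.assoc, reassoc_of% h₁]
      rw [← rightUnitor_naturality]
      simp only [← tensorHom_id, ← id_tensorHom, tensorHom_comp_tensorHom_assoc, Category.id_comp,
        Category.comp_id]
    _ = _ := by
      rw [← h, ← comp_whiskerRight_assoc, ComonObj.comul_counit, MonoidalCategory.tensorHom_def]
      simp

end ActionMaps

section Diag

variable {𝒞 : Type u} [Category.{v} 𝒞] [MonoidalCategory 𝒞] [BraidedCategory 𝒞]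
variable (H C : 𝒞) [HopfObj H] [ModObj H C]

theorem diagAct_zero : diagAct H C 0 = unitAct H := by
  simp [diagAct, unitAct, iterComul, tpowShuffle, tpowMap, tpow]

/-- Splits off the first tensor factor, so that statements about the diagonal action on tensor
powers go by induction through `tensorAct`. -/
theorem diagAct_succ (n : ℕ) :
    diagAct H C (n + 1) = tensorAct (γ[H, C] : H ⊗ C ⟶ C) (diagAct H C n) := by
  simp only [diagAct, tensorAct, iterComul, tpowShuffle, tpowMap, tpow]
  have := tensorμ_natural_left (𝟙 H) (iterComul H n) C (tpow C n)
  simp only [id_tensorHom, id_whiskerRight] at this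
  simp only [comp_whiskerRight, Category.assoc, reassoc_of% this]
  simp only [← id_tensorHom, tensorHom_comp_tensorHom, Category.id_comp]

theorem intertwines_tpowSnoc (n : ℕ) :
    Intertwines (tensorAct (diagAct H C n) (γ[H, C] : H ⊗ C ⟶ C)) (diagAct H C (n + 1))
      (tpowSnoc C n).hom := by
  induction n with
  | zero =>
    rw [diagAct_succ, diagAct_zero]
    exact (intertwines_leftUnitor _).comp (Intertwines.iso_inv (ρ_ C) (intertwines_rightUnitor _))
  | succ n ih =>
    rw [diagAct_succ H C (n + 1)]
    have := intertwines_associator (γ[H, C] : H ⊗ C ⟶ C) (diagAct H C n) (γ[H, C] : H ⊗ C ⟶ C)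
    rw [← diagAct_succ] at this
    exact this.comp (ih.whiskerLeft _)

end Diag

section ModCoalg

variable {𝒞 : Type u} [Category.{v} 𝒞] [MonoidalCategory 𝒞] [BraidedCategory 𝒞]
variable (H C : 𝒞) [HopfObj H] [ModuleCoalgObj H C]

theorem intertwines_comul :
    Intertwines (γ[H, C] : H ⊗ C ⟶ C) (tensorAct (γ[H, C] : H ⊗ C ⟶ C) (γ[H, C] : H ⊗ C ⟶ C))
      Δ[C] := by
  unfold Intertwines tensorAct
  rw [ModuleCoalgObj.smul_comul, tensorHom_def', Category.assoc]

theorem intertwines_counit : Intertwines (γ[H, C] : H ⊗ C ⟶ C) (unitAct H) ε[C] := by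
  unfold Intertwines unitAct
  rw [ModuleCoalgObj.smul_counit, tensorHom_def', Category.assoc]

theorem intertwines_comulAt (n : ℕ) (i : Fin n) :
    Intertwines (diagAct H C n) (diagAct H C (n + 1)) (comulAt C n i) := by
  induction n with
  | zero => exact i.elim0
  | succ n ih =>
    rw [diagAct_succ H C (n + 1)]
    induction i using Fin.cases with
    | zero =>
      rw [diagAct_succ H C n]
      exact ((intertwines_comul H C).whiskerRight _).comp (intertwines_associator _ _ _)
    | succ i =>
      nth_rewrite 1 [diagAct_succ H C n]
      exact (ih i).whiskerLeft _

theorem intertwines_counitAt (n : ℕ) (i : Fin (n + 1)) :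
    Intertwines (diagAct H C (n + 1)) (diagAct H C n) (counitAt C n i) := by
  induction n with
  | zero =>
    rw [diagAct_succ]
    exact ((intertwines_counit H C).whiskerRight _).comp (intertwines_leftUnitor _)
  | succ n ih =>
    rw [diagAct_succ H C (n + 1)]
    induction i using Fin.cases with
    | zero =>
      exact ((intertwines_counit H C).whiskerRight _).comp (intertwines_leftUnitor _)
    | succ i =>
      nth_rewrite 2 [diagAct_succ H C n]
      exact (ih i).whiskerLeft _

end ModCoalg

/-! ### The half-braiding of a comodule and rotations of tensor factors -/

section HalfBraiding

variable {𝒞 : Type u} [Category.{v} 𝒞] [MonoidalCategory 𝒞] [BraidedCategory 𝒞]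
variable {H : 𝒞} [ComonObj H] (M : 𝒞) [LeftComodObj H M]

/-- The map `m ⊗ v ↦ m₍₋₁₎ v ⊗ m₍₀₎`. -/
def halfBraiding {V : 𝒞} (φ : H ⊗ V ⟶ V) : M ⊗ V ⟶ V ⊗ M :=
  (LeftComodObj.coact : M ⟶ H ⊗ M) ▷ V ≫ (α_ H M V).hom ≫ H ◁ (β_ M V).hom ≫
    (α_ H V M).inv ≫ φ ▷ M

theorem halfBraiding_naturality {V W : 𝒞} {φ : H ⊗ V ⟶ V} {χ : H ⊗ W ⟶ W} {f : V ⟶ W}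
    (hf : Intertwines φ χ f) :
    M ◁ f ≫ halfBraiding M χ = halfBraiding M φ ≫ f ▷ M := by
  unfold Intertwines at hf
  simp only [halfBraiding, Category.assoc, ← comp_whiskerRight, hf]
  rw [whisker_exchange_assoc, associator_naturality_right_assoc, ← whiskerLeft_comp_assoc,
    braiding_naturality_right]
  simp

theorem halfBraiding_unitAct :
    halfBraiding M (unitAct H) = (ρ_ M).hom ≫ (λ_ M).inv := by
  have h := LeftComodObj.counit_coact (H := H) (M := M)
  unfold halfBraiding unitAct
  rw [braiding_tensorUnit_right]
  calc
    _ = (LeftComodObj.coact ≫ ε[H] ▷ M) ▷ 𝟙_ 𝒞 ⊗≫ 𝟙 _ := by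
      monoidal
    _ = _ := by rw [h]; monoidal

/-- The hexagon for the half-braiding. Coassociativity of the coaction replaces the two legs of
Δ(m₍₋₁₎) by two successive coactions: the first acts on V, the second on W. -/
theorem halfBraiding_tensorAct {V W : 𝒞} (φ : H ⊗ V ⟶ V) (χ : H ⊗ W ⟶ W) :
    halfBraiding M (tensorAct φ χ) = (α_ M V W).inv ≫ halfBraiding M φ ▷ W ≫ (α_ V M W).hom ≫
      V ◁ halfBraiding M χ ≫ (α_ V W M).inv := by
  have h := LeftComodObj.comul_coact (H := H) (M := M)
  unfold halfBraiding tensorAct tensorμ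
  rw [MonoidalCategory.tensorHom_def]
  set c := (LeftComodObj.coact : M ⟶ H ⊗ M)
  calc
    _ = 𝟙 _ ⊗≫ c ▷ (V ⊗ W) ⊗≫ (H ◁ (β_ M (V ⊗ W)).hom ≫ Δ[H] ▷ ((V ⊗ W) ⊗ M)) ⊗≫
        H ◁ (β_ H V).hom ▷ (W ⊗ M) ⊗≫ φ ▷ (H ⊗ W ⊗ M) ⊗≫ V ◁ χ ▷ M ⊗≫ 𝟙 _ := by monoidal
    _ = 𝟙 _ ⊗≫ (c ≫ Δ[H] ▷ M) ▷ (V ⊗ W) ⊗≫ (H ⊗ H) ◁ (β_ M (V ⊗ W)).hom ⊗≫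
        H ◁ (β_ H V).hom ▷ (W ⊗ M) ⊗≫ φ ▷ (H ⊗ W ⊗ M) ⊗≫ V ◁ χ ▷ M ⊗≫ 𝟙 _ := by
      rw [whisker_exchange]; monoidal
    _ = 𝟙 _ ⊗≫ c ▷ (V ⊗ W) ⊗≫ H ◁ c ▷ (V ⊗ W) ⊗≫ (H ⊗ H) ◁ (β_ M V).hom ▷ W ⊗≫
        H ◁ ((H ⊗ V) ◁ (β_ M W).hom ≫ (β_ H V).hom ▷ (W ⊗ M)) ⊗≫
        φ ▷ (H ⊗ W ⊗ M) ⊗≫ V ◁ χ ▷ M ⊗≫ 𝟙 _ := by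
      rw [h, braiding_tensor_right_hom]; monoidal
    _ = 𝟙 _ ⊗≫ c ▷ (V ⊗ W) ⊗≫ H ◁ (c ▷ V ≫ (β_ (H ⊗ M) V).hom) ▷ W ⊗≫
        ((H ⊗ V) ◁ (H ◁ (β_ M W).hom) ≫ φ ▷ (H ⊗ W ⊗ M)) ⊗≫ V ◁ χ ▷ M ⊗≫ 𝟙 _ := by
      rw [whisker_exchange, braiding_tensor_left_hom]; monoidal
    _ = 𝟙 _ ⊗≫ c ▷ (V ⊗ W) ⊗≫ H ◁ (β_ M V).hom ▷ W ⊗≫ ((H ⊗ V) ◁ c ▷ W ≫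
        φ ▷ ((H ⊗ M) ⊗ W)) ⊗≫ V ◁ H ◁ (β_ M W).hom ⊗≫ V ◁ χ ▷ M ⊗≫ 𝟙 _ := by
      rw [braiding_naturality_left, whisker_exchange]; monoidal
    _ = _ := by rw [whisker_exchange]; monoidal

end HalfBraiding

section Rotate

variable {𝒞 : Type u} [Category.{v} 𝒞] [MonoidalCategory 𝒞] [SymmetricCategory 𝒞]
variable {H : 𝒞} [ComonObj H] (M : 𝒞) [LeftComodObj H M]

/-- The map `m ⊗ v ⊗ x ↦ m₍₀₎ ⊗ x ⊗ m₍₋₁₎ v`. -/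
def rotate {V : 𝒞} (φ : H ⊗ V ⟶ V) (X : 𝒞) : M ⊗ V ⊗ X ⟶ M ⊗ X ⊗ V :=
  (α_ M V X).inv ≫ halfBraiding M φ ▷ X ≫ (α_ V M X).hom ≫ (β_ V (M ⊗ X)).hom ≫
    (α_ M X V).hom

theorem rotate_naturality_right {V X Y : 𝒞} (φ : H ⊗ V ⟶ V) (f : X ⟶ Y) :
    M ◁ V ◁ f ≫ rotate M φ Y = rotate M φ X ≫ M ◁ f ▷ V := by
  have h : M ◁ V ◁ f ≫ (α_ M V Y).inv ≫ halfBraiding M φ ▷ Y =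
      (α_ M V X).inv ≫ halfBraiding M φ ▷ X ≫ (V ⊗ M) ◁ f := by
    rw [← whisker_exchange, ← associator_inv_naturality_right_assoc]
  simp only [rotate, Category.assoc, reassoc_of% h]
  rw [associator_naturality_right_assoc, braiding_naturality_right_assoc, associator_naturality_middle]

theorem rotate_naturality_left {V W : 𝒞} {φ : H ⊗ V ⟶ V} {χ : H ⊗ W ⟶ W} {f : V ⟶ W}
    (hf : Intertwines φ χ f) (X : 𝒞) :
    M ◁ f ▷ X ≫ rotate M χ X = rotate M φ X ≫ M ◁ X ◁ f := by
  have h := halfBraiding_naturality M hf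
  simp only [rotate, Category.assoc, associator_inv_naturality_middle_assoc]
  rw [← comp_whiskerRight_assoc, h, comp_whiskerRight_assoc, associator_naturality_left_assoc,
    braiding_naturality_left_assoc, associator_naturality_right]

theorem rotate_unitAct (X : 𝒞) :
    rotate M (unitAct H) X = M ◁ ((λ_ X).hom ≫ (ρ_ X).inv) := by
  rw [rotate, halfBraiding_unitAct, braiding_tensorUnit_left]
  monoidal

/-- On the left V crosses W and later W crosses back over V; in a symmetric category this double
crossing is trivial. -/
theorem braiding_comp_braiding (V W Y : 𝒞) :
    (β_ V (W ⊗ Y)).hom ≫ (α_ W Y V).hom ≫ (β_ W (Y ⊗ V)).hom =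
      (α_ V W Y).inv ≫ (β_ (V ⊗ W) Y).hom ≫ (α_ Y V W).inv := by
  have hs : (β_ V W).hom ▷ Y ≫ (β_ W V).hom ▷ Y = 𝟙 _ := by
    rw [← comp_whiskerRight, SymmetricCategory.symmetry, id_whiskerRight]
  calc
    _ = 𝟙 _ ⊗≫ (β_ V W).hom ▷ Y ⊗≫ (W ◁ (β_ V Y).hom ≫ (β_ W (Y ⊗ V)).hom) := by
      rw [braiding_tensor_right_hom V W Y]; monoidal
    _ = 𝟙 _ ⊗≫ ((β_ V W).hom ▷ Y ≫ (β_ W V).hom ▷ Y) ⊗≫ V ◁ (β_ W Y).hom ⊗≫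
        (β_ V Y).hom ▷ W := by
      rw [braiding_naturality_right, braiding_tensor_right_hom W V Y]; monoidal
    _ = _ := by rw [hs, braiding_tensor_left_hom]; monoidal

/-- The hexagon for the half-braiding together with `braiding_comp_braiding`. All computations with
several cyclic maps in a row rest on it. -/
theorem rotate_tensorAct {V W : 𝒞} (φ : H ⊗ V ⟶ V) (χ : H ⊗ W ⟶ W) (X : 𝒞) :
    rotate M (tensorAct φ χ) X = M ◁ (α_ V W X).hom ≫ rotate M φ (W ⊗ X) ≫
      M ◁ (α_ W X V).hom ≫ rotate M χ (X ⊗ V) ≫ M ◁ (α_ X V W).hom := by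
  have h₁ := braiding_naturality_right V
    ((α_ M W X).inv ≫ halfBraiding M χ ▷ X ≫ (α_ W M X).hom)
  have h₂ : (β_ W (M ⊗ X ⊗ V)).hom =
      W ◁ (α_ M X V).inv ≫ (β_ W ((M ⊗ X) ⊗ V)).hom ≫ (α_ M X V).hom ▷ W := by
    rw [← braiding_naturality_right, ← whiskerLeft_comp_assoc, Iso.inv_hom_id, whiskerLeft_id,
      Category.id_comp]
  have h₃ := braiding_comp_braiding V W (M ⊗ X)
  symm
  unfold rotate
  rw [h₂]
  calc
    _ = 𝟙 _ ⊗≫ halfBraiding M φ ▷ (W ⊗ X) ⊗≫ ((β_ V (M ⊗ W ⊗ X)).hom ≫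
        ((α_ M W X).inv ≫ halfBraiding M χ ▷ X ≫ (α_ W M X).hom) ▷ V) ⊗≫
        (β_ W ((M ⊗ X) ⊗ V)).hom ⊗≫ 𝟙 _ := by monoidal
    _ = 𝟙 _ ⊗≫ halfBraiding M φ ▷ (W ⊗ X) ⊗≫ V ◁ halfBraiding M χ ▷ X ⊗≫
        ((β_ V (W ⊗ M ⊗ X)).hom ≫ (α_ W (M ⊗ X) V).hom ≫ (β_ W ((M ⊗ X) ⊗ V)).hom) ⊗≫ 𝟙 _ := by
      rw [← h₁]; monoidal
    _ = _ := by
      rw [h₃, halfBraiding_tensorAct]; monoidal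

/-- In `rotate`, M passes V and returns; symmetry cancels the two crossings, which leaves the form
in which the cyclic maps are given. -/
theorem rotate_eq {V : 𝒞} (φ : H ⊗ V ⟶ V) (X : 𝒞) :
    rotate M φ X = (LeftComodObj.coact : M ⟶ H ⊗ M) ▷ (V ⊗ X) ≫ (β_ H M).hom ▷ (V ⊗ X) ≫
      (α_ M H (V ⊗ X)).hom ≫ M ◁ ((α_ H V X).inv ≫ φ ▷ X ≫ (β_ V X).hom) := by
  unfold rotate halfBraiding
  set c := (LeftComodObj.coact : M ⟶ H ⊗ M)
  have hs : H ◁ (β_ M V).hom ≫ H ◁ (β_ V M).hom = 𝟙 _ := by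
    rw [← whiskerLeft_comp, SymmetricCategory.symmetry, whiskerLeft_id]
  calc
    _ = 𝟙 _ ⊗≫ c ▷ (V ⊗ X) ⊗≫ H ◁ (β_ M V).hom ▷ X ⊗≫ (φ ▷ M ≫ (β_ V M).hom) ▷ X ⊗≫
        M ◁ (β_ V X).hom := by
      rw [braiding_tensor_right_hom]; monoidal
    _ = 𝟙 _ ⊗≫ c ▷ (V ⊗ X) ⊗≫ (H ◁ (β_ M V).hom ≫ H ◁ (β_ V M).hom) ▷ X ⊗≫
        (β_ H M).hom ▷ (V ⊗ X) ⊗≫ M ◁ φ ▷ X ⊗≫ M ◁ (β_ V X).hom := by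
      rw [braiding_naturality_left, braiding_tensor_left_hom]; monoidal
    _ = _ := by rw [hs]; monoidal

end Rotate

/-! ### Pushing H through a factor and cancelling the antipode -/

section PushAct

variable {𝒞 : Type u} [Category.{v} 𝒞] [MonoidalCategory 𝒞] [BraidedCategory 𝒞]
variable {H : 𝒞} [ComonObj H]

/-- The map `h ⊗ v ↦ h⁽¹⁾ v ⊗ h⁽²⁾`. -/
def pushAct {V : 𝒞} (φ : H ⊗ V ⟶ V) : H ⊗ V ⟶ V ⊗ H :=
  Δ[H] ▷ V ≫ (α_ H H V).hom ≫ H ◁ (β_ H V).hom ≫ (α_ H V H).inv ≫ φ ▷ H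

theorem tensorAct_eq_pushAct {V W : 𝒞} (φ : H ⊗ V ⟶ V) (χ : H ⊗ W ⟶ W) :
    tensorAct φ χ = (α_ H V W).inv ≫ pushAct φ ▷ W ≫ (α_ V H W).hom ≫ V ◁ χ := by
  unfold tensorAct pushAct tensorμ
  rw [MonoidalCategory.tensorHom_def]
  monoidal

theorem pushAct_comp_counit {V : 𝒞} (φ : H ⊗ V ⟶ V) :
    pushAct φ ≫ V ◁ ε[H] = φ ≫ (ρ_ V).inv := by
  have h : (β_ H V).hom ≫ V ◁ ε[H] = ε[H] ▷ V ≫ (λ_ V).hom ≫ (ρ_ V).inv := by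
    rw [← braiding_naturality_left, braiding_tensorUnit_left]
  unfold pushAct
  calc
    _ = 𝟙 _ ⊗≫ Δ[H] ▷ V ⊗≫ H ◁ (β_ H V).hom ⊗≫ (φ ▷ H ≫ V ◁ ε[H]) := by monoidal
    _ = 𝟙 _ ⊗≫ Δ[H] ▷ V ⊗≫ H ◁ ((β_ H V).hom ≫ V ◁ ε[H]) ⊗≫ φ ▷ 𝟙_ 𝒞 := by
      rw [← whisker_exchange]; monoidal
    _ = 𝟙 _ ⊗≫ (Δ[H] ≫ H ◁ ε[H]) ▷ V ⊗≫ φ ▷ 𝟙_ 𝒞 := by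
      rw [h]; monoidal
    _ = _ := by rw [ComonObj.comul_counit]; monoidal

theorem comul_comp_pushAct {V : 𝒞} (φ : H ⊗ V ⟶ V) :
    Δ[H] ▷ V ≫ (α_ H H V).hom ≫ H ◁ (β_ H V).hom ≫ (α_ H V H).inv ≫ pushAct φ ▷ H ≫
      (α_ V H H).hom = pushAct φ ≫ V ◁ Δ[H] := by
  have h := ComonObj.comul_assoc H
  unfold pushAct
  symm
  calc
    _ = 𝟙 _ ⊗≫ Δ[H] ▷ V ⊗≫ H ◁ (β_ H V).hom ⊗≫ (φ ▷ H ≫ V ◁ Δ[H]) := by monoidal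
    _ = 𝟙 _ ⊗≫ Δ[H] ▷ V ⊗≫ H ◁ ((β_ H V).hom ≫ V ◁ Δ[H]) ⊗≫ φ ▷ (H ⊗ H) := by
      rw [← whisker_exchange]; monoidal
    _ = 𝟙 _ ⊗≫ (Δ[H] ≫ H ◁ Δ[H]) ▷ V ⊗≫ (H ⊗ H) ◁ (β_ H V).hom ⊗≫ H ◁ (β_ H V).hom ▷ H ⊗≫
        φ ▷ (H ⊗ H) := by
      rw [← braiding_naturality_left, braiding_tensor_left_hom]; monoidal
    _ = 𝟙 _ ⊗≫ Δ[H] ▷ V ⊗≫ (Δ[H] ▷ (H ⊗ V) ≫ (H ⊗ H) ◁ (β_ H V).hom) ⊗≫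
        H ◁ (β_ H V).hom ▷ H ⊗≫ φ ▷ (H ⊗ H) := by
      rw [h]; monoidal
    _ = _ := by rw [← whisker_exchange]; monoidal

end PushAct

section Antipode

variable {𝒞 : Type u} [Category.{v} 𝒞] [MonoidalCategory 𝒞] [BraidedCategory 𝒞]
variable {H : 𝒞} [HopfObj H]

/-- The map `h ⊗ v ↦ h⁽¹⁾ ⊗ S(h⁽²⁾) v`. -/
def antipodeAct {V : 𝒞} (φ : H ⊗ V ⟶ V) : H ⊗ V ⟶ H ⊗ V :=
  Δ[H] ▷ V ≫ (α_ H H V).hom ≫ H ◁ (𝒮[H] ▷ V ≫ φ)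

variable {V : 𝒞}

/-- `φ` is a unital and associative action of `H` on `V`. -/
structure IsAction (φ : H ⊗ V ⟶ V) : Prop where
  one_act : η[H] ▷ V ≫ φ = (λ_ V).hom
  mul_act : μ[H] ▷ V ≫ φ = (α_ H H V).hom ≫ H ◁ φ ≫ φ

theorem isAction_smul [ModObj H V] : IsAction (γ[H, V] : H ⊗ V ⟶ V) :=
  ⟨by simp, by simp⟩

variable {φ : H ⊗ V ⟶ V}

theorem antipodeAct_comp_act (hφ : IsAction φ) :
    antipodeAct φ ≫ φ = ε[H] ▷ V ≫ (λ_ V).hom := by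
  unfold antipodeAct
  calc
    _ = (Δ[H] ≫ H ◁ 𝒮[H]) ▷ V ≫ (α_ H H V).hom ≫ H ◁ φ ≫
        φ := by simp
    _ = (Δ[H] ≫ H ◁ 𝒮[H] ≫ μ[H]) ▷ V ≫ φ := by
      rw [← hφ.mul_act]; simp only [comp_whiskerRight, Category.assoc]
    _ = _ := by rw [HopfObj.antipode_right, comp_whiskerRight_assoc, hφ.one_act]

/-- In Sweedler notation, v ⊗ h ⊗ x goes to h⁽¹⁾x ⊗ h⁽²⁾S(h⁽³⁾)v = hx ⊗ v. This removes the antipode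
that the anti-Yetter–Drinfeld condition introduces. -/
theorem antipodeAct_comp_tensorAct (hφ : IsAction φ) {X : 𝒞} (χ : H ⊗ X ⟶ X) :
    (β_ V H).hom ▷ X ≫ antipodeAct φ ▷ X ≫ (α_ H V X).hom ≫
      H ◁ (β_ V X).hom ≫ tensorAct χ φ =
    (α_ V H X).hom ≫ V ◁ χ ≫ (β_ V X).hom := by
  have h := antipodeAct_comp_act hφ
  have h₁ := comul_comp_pushAct χ
  have h₂ := pushAct_comp_counit χ
  rw [tensorAct_eq_pushAct]
  unfold antipodeAct at h ⊢
  calc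
    _ = (β_ V H).hom ▷ X ⊗≫ Δ[H] ▷ (V ⊗ X) ⊗≫
        H ◁ ((𝒮[H] ▷ V ≫ φ) ▷ X ≫ (β_ V X).hom) ⊗≫ pushAct χ ▷ V ⊗≫ X ◁ φ := by monoidal
    _ = (β_ V H).hom ▷ X ⊗≫ (Δ[H] ▷ (V ⊗ X) ≫ (H ⊗ H) ◁ (β_ V X).hom) ⊗≫
        H ◁ (β_ H X).hom ▷ V ⊗≫ ((H ⊗ X) ◁ (𝒮[H] ▷ V ≫ φ) ≫ pushAct χ ▷ V) ⊗≫ X ◁ φ := by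
      rw [braiding_naturality_left, braiding_tensor_left_hom]; monoidal
    _ = (β_ V H).hom ▷ X ⊗≫ (Δ[H] ▷ (V ⊗ X) ≫ (H ⊗ H) ◁ (β_ V X).hom) ⊗≫
        H ◁ (β_ H X).hom ▷ V ⊗≫ pushAct χ ▷ (H ⊗ V) ⊗≫ X ◁ H ◁ (𝒮[H] ▷ V ≫ φ) ⊗≫ X ◁ φ := by
      rw [whisker_exchange]; monoidal
    _ = (β_ V H).hom ▷ X ⊗≫ H ◁ (β_ V X).hom ⊗≫
        (Δ[H] ▷ X ≫ (α_ H H X).hom ≫ H ◁ (β_ H X).hom ≫ (α_ H X H).inv ≫ pushAct χ ▷ H ≫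
          (α_ X H H).hom) ▷ V ⊗≫ X ◁ H ◁ (𝒮[H] ▷ V ≫ φ) ⊗≫ X ◁ φ := by
      rw [← whisker_exchange]; monoidal
    _ = (β_ V H).hom ▷ X ⊗≫ H ◁ (β_ V X).hom ⊗≫ pushAct χ ▷ V ⊗≫
        X ◁ ((Δ[H] ▷ V ≫ (α_ H H V).hom ≫ H ◁ (𝒮[H] ▷ V ≫ φ)) ≫ φ) ⊗≫ 𝟙 _ := by
      rw [h₁]; monoidal
    _ = (β_ V H).hom ▷ X ⊗≫ H ◁ (β_ V X).hom ⊗≫ (pushAct χ ≫ X ◁ ε[H]) ▷ V ⊗≫ 𝟙 _ := by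
      rw [h]; monoidal
    _ = 𝟙 _ ⊗≫ ((β_ V (H ⊗ X)).hom ≫ χ ▷ V) ⊗≫ 𝟙 _ := by
      rw [h₂, braiding_tensor_right_hom]; monoidal
    _ = _ := by rw [← braiding_naturality_right]; monoidal

end Antipode

/-! ### The anti-Yetter–Drinfeld condition, stability and balanced maps -/

section SAYD

variable {𝒞 : Type u} [Category.{v} 𝒞] [MonoidalCategory 𝒞] [SymmetricCategory 𝒞]

/-- Both sides realize the permutation A, M, B, C, D ↦ M, C, D, A, B. It will be used with A
carrying m₍₋₁₎ and B, C, D carrying the three legs of h. -/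
theorem anti_yetter_drinfeld_permutation (A M B C D : 𝒞) :
    A ◁ (β_ M B).hom ▷ (C ⊗ D) ⊗≫ (A ⊗ B ⊗ M) ◁ (β_ C D).hom ⊗≫
      (A ⊗ B) ◁ (β_ M D).hom ▷ C ⊗≫ (β_ (A ⊗ B) D).hom ▷ (M ⊗ C) ⊗≫
      (β_ (D ⊗ A ⊗ B) (M ⊗ C)).hom =
    𝟙 _ ⊗≫ (β_ A M).hom ▷ (B ⊗ C ⊗ D) ⊗≫ M ◁ (β_ (A ⊗ B) (C ⊗ D)).hom ⊗≫ 𝟙 _ := by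
  have h₁ : M ◁ (β_ C D).hom ⊗≫ (β_ M D).hom ▷ C ⊗≫ (β_ D (M ⊗ C)).hom = (α_ M C D).inv := by
    have h₂ : (β_ M D).hom ▷ C ≫ (β_ D M).hom ▷ C = 𝟙 _ := by
      rw [← comp_whiskerRight, SymmetricCategory.symmetry, id_whiskerRight]
    have h₃ : M ◁ (β_ C D).hom ≫ M ◁ (β_ D C).hom = 𝟙 _ := by
      rw [← whiskerLeft_comp, SymmetricCategory.symmetry, whiskerLeft_id]
    calc
      _ = M ◁ (β_ C D).hom ⊗≫ ((β_ M D).hom ▷ C ≫ (β_ D M).hom ▷ C) ⊗≫ M ◁ (β_ D C).hom ⊗≫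
          𝟙 _ := by rw [braiding_tensor_right_hom]; monoidal
      _ = (M ◁ (β_ C D).hom ≫ M ◁ (β_ D C).hom) ⊗≫ 𝟙 _ := by rw [h₂]; monoidal
      _ = _ := by rw [h₃]; monoidal
  have h₄ : A ◁ (β_ M B).hom ≫ A ◁ (β_ B M).hom = 𝟙 _ := by
    rw [← whiskerLeft_comp, SymmetricCategory.symmetry, whiskerLeft_id]
  calc
    _ = A ◁ (β_ M B).hom ▷ (C ⊗ D) ⊗≫ (A ⊗ B ⊗ M) ◁ (β_ C D).hom ⊗≫
        (A ⊗ B) ◁ (β_ M D).hom ▷ C ⊗≫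
        ((β_ (A ⊗ B) (D ⊗ M ⊗ C)).hom ≫ (β_ D (M ⊗ C)).hom ▷ (A ⊗ B)) ⊗≫ 𝟙 _ := by
      rw [braiding_tensor_left_hom D (A ⊗ B) (M ⊗ C), braiding_tensor_right_hom (A ⊗ B) D (M ⊗ C)]
      monoidal
    _ = A ◁ (β_ M B).hom ▷ (C ⊗ D) ⊗≫ (A ⊗ B) ◁ (M ◁ (β_ C D).hom ⊗≫
        (β_ M D).hom ▷ C ⊗≫ (β_ D (M ⊗ C)).hom) ⊗≫
        (β_ (A ⊗ B) ((M ⊗ C) ⊗ D)).hom ⊗≫ 𝟙 _ := by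
      rw [← braiding_naturality_right]; monoidal
    _ = A ◁ (β_ M B).hom ▷ (C ⊗ D) ⊗≫ ((A ⊗ B) ◁ (α_ M C D).inv ≫
        (β_ (A ⊗ B) ((M ⊗ C) ⊗ D)).hom) ⊗≫ 𝟙 _ := by
      rw [h₁]; monoidal
    _ = 𝟙 _ ⊗≫ (A ◁ (β_ M B).hom ≫ A ◁ (β_ B M).hom) ▷ (C ⊗ D) ⊗≫
        (β_ A M).hom ▷ (B ⊗ C ⊗ D) ⊗≫ M ◁ (β_ (A ⊗ B) (C ⊗ D)).hom ⊗≫ 𝟙 _ := by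
      rw [braiding_naturality_right, braiding_tensor_right_hom (A ⊗ B) M (C ⊗ D),
        braiding_tensor_left_hom A B M]
      monoidal
    _ = _ := by rw [h₄]; monoidal

variable {H : 𝒞} [HopfObj H] (M : 𝒞) [SAYDObj H M]

/-- The anti-Yetter–Drinfeld axiom with M brought to the front: (mh)₍₀₎ ⊗ (mh)₍₋₁₎ = m₍₀₎h⁽²⁾ ⊗
S(h⁽³⁾)m₍₋₁₎h⁽¹⁾. -/
theorem act_comp_coact_comp_braiding :
    (RightModObj.act : M ⊗ H ⟶ M) ≫ (LeftComodObj.coact : M ⟶ H ⊗ M) ≫ (β_ H M).hom =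
      ((LeftComodObj.coact : M ⟶ H ⊗ M) ⊗ₘ (Δ[H] ≫ H ◁ Δ[H])) ⊗≫
        (β_ H M).hom ▷ (H ⊗ H ⊗ H) ⊗≫ M ◁ (β_ (H ⊗ H) (H ⊗ H)).hom ⊗≫
        ((RightModObj.act : M ⊗ H ⟶ M) ⊗ₘ ((𝒮[H] ⊗ₘ μ[H]) ≫ μ[H])) := by
  have h := SAYDObj.anti_yetter_drinfeld (H := H) (M := M)
  have hp := anti_yetter_drinfeld_permutation H M H H H
  rw [reassoc_of% h]
  set c := (LeftComodObj.coact : M ⟶ H ⊗ M)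
  set a := (RightModObj.act : M ⊗ H ⟶ M)
  calc
    _ = (c ⊗ₘ (Δ[H] ≫ H ◁ Δ[H])) ⊗≫
        H ◁ (β_ M H).hom ▷ (H ⊗ H) ⊗≫
        (H ⊗ H ⊗ M) ◁ (β_ H H).hom ⊗≫
        (H ⊗ H) ◁ (β_ M H).hom ▷ H ⊗≫
        (β_ (H ⊗ H) H).hom ▷ (M ⊗ H) ⊗≫
        ((((𝒮[H] ⊗ₘ μ[H]) ≫ μ[H]) ⊗ₘ a) ≫ (β_ H M).hom) := by
      simp only [monoidalComp, Category.assoc]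
    _ = (c ⊗ₘ (Δ[H] ≫ H ◁ Δ[H])) ⊗≫
        (H ◁ (β_ M H).hom ▷ (H ⊗ H) ⊗≫ (H ⊗ H ⊗ M) ◁ (β_ H H).hom ⊗≫
        (H ⊗ H) ◁ (β_ M H).hom ▷ H ⊗≫ (β_ (H ⊗ H) H).hom ▷ (M ⊗ H) ⊗≫
        (β_ (H ⊗ H ⊗ H) (M ⊗ H)).hom) ⊗≫ (a ⊗ₘ ((𝒮[H] ⊗ₘ μ[H]) ≫ μ[H])) := by
      rw [braiding_naturality]; monoidal
    _ = _ := by rw [hp]; monoidal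

/-- Both sides send k ⊗ h ⊗ v to h⁽²⁾ ⊗ S(h⁽³⁾)k h⁽¹⁾v. With k = m₍₋₁₎ this is the pattern of the
anti-Yetter–Drinfeld axiom. -/
theorem pushAct_comp_antipodeAct {V : 𝒞} (φ : H ⊗ V ⟶ V) :
    H ◁ pushAct φ ⊗≫ φ ▷ H ⊗≫ (β_ V H).hom ⊗≫ antipodeAct φ =
      H ◁ (Δ[H] ≫ H ◁ Δ[H]) ▷ V ⊗≫ (β_ (H ⊗ H) (H ⊗ H)).hom ▷ V ⊗≫
        (H ⊗ H) ◁ (H ◁ φ ≫ φ) ⊗≫ H ◁ (𝒮[H] ▷ V ≫ φ) := by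
  have hs : (β_ (H ⊗ H) V).hom ≫ (β_ V (H ⊗ H)).hom = 𝟙 _ := SymmetricCategory.symmetry _ _
  -- Rebracketing the source lets the hexagon separate V from the pair H ⊗ H.
  have hα : (β_ (H ⊗ H ⊗ V) (H ⊗ H)).hom =
      (α_ H H V).inv ▷ (H ⊗ H) ≫ (β_ ((H ⊗ H) ⊗ V) (H ⊗ H)).hom ≫ (H ⊗ H) ◁ (α_ H H V).hom := by
    rw [← braiding_naturality_left, ← comp_whiskerRight_assoc, Iso.inv_hom_id, id_whiskerRight,
      Category.id_comp]
  unfold pushAct antipodeAct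
  calc
    _ = H ◁ Δ[H] ▷ V ⊗≫ H ◁ H ◁ (β_ H V).hom ⊗≫ ((H ◁ φ ≫ φ) ▷ H ≫ (β_ V H).hom) ⊗≫
        Δ[H] ▷ V ⊗≫ H ◁ (𝒮[H] ▷ V ≫ φ) := by monoidal
    _ = H ◁ Δ[H] ▷ V ⊗≫ H ◁ H ◁ (β_ H V).hom ⊗≫ (β_ (H ⊗ H ⊗ V) H).hom ⊗≫
        (H ◁ (H ◁ φ ≫ φ) ≫ Δ[H] ▷ V) ⊗≫ H ◁ (𝒮[H] ▷ V ≫ φ) := by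
      rw [braiding_naturality_left]; monoidal
    _ = H ◁ Δ[H] ▷ V ⊗≫ H ◁ H ◁ (β_ H V).hom ⊗≫ ((β_ (H ⊗ H ⊗ V) H).hom ≫
        Δ[H] ▷ (H ⊗ H ⊗ V)) ⊗≫ (H ⊗ H) ◁ (H ◁ φ ≫ φ) ⊗≫ H ◁ (𝒮[H] ▷ V ≫ φ) := by
      rw [whisker_exchange]; monoidal
    _ = H ◁ Δ[H] ▷ V ⊗≫ H ◁ H ◁ ((β_ H V).hom ≫ V ◁ Δ[H]) ⊗≫ (β_ (H ⊗ H ⊗ V) (H ⊗ H)).hom ⊗≫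
        (H ⊗ H) ◁ (H ◁ φ ≫ φ) ⊗≫ H ◁ (𝒮[H] ▷ V ≫ φ) := by
      rw [← braiding_naturality_right]; monoidal
    _ = H ◁ (Δ[H] ≫ H ◁ Δ[H]) ▷ V ⊗≫ H ◁ H ◁ ((β_ (H ⊗ H) V).hom ≫ (β_ V (H ⊗ H)).hom) ⊗≫
        (β_ (H ⊗ H) (H ⊗ H)).hom ▷ V ⊗≫
        (H ⊗ H) ◁ (H ◁ φ ≫ φ) ⊗≫ H ◁ (𝒮[H] ▷ V ≫ φ) := by
      rw [← braiding_naturality_left, hα, braiding_tensor_left_hom (H ⊗ H) V (H ⊗ H)]; monoidal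
    _ = _ := by rw [hs]; monoidal

/-- The map `m ⊗ v ↦ m₍₀₎ ⊗ m₍₋₁₎ v`. -/
def coactAct {V : 𝒞} (φ : H ⊗ V ⟶ V) : M ⊗ V ⟶ M ⊗ V :=
  (LeftComodObj.coact : M ⟶ H ⊗ M) ▷ V ≫ (β_ H M).hom ▷ V ≫ (α_ M H V).hom ≫ M ◁ φ

theorem act_comp_coactAct {V : 𝒞} {φ : H ⊗ V ⟶ V} (hφ : IsAction φ) :
    (RightModObj.act : M ⊗ H ⟶ M) ▷ V ≫ coactAct M φ =
      (α_ M H V).hom ≫ M ◁ pushAct φ ≫ (α_ M V H).inv ≫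
        coactAct M φ ▷ H ≫ (α_ M V H).hom ≫
        M ◁ ((β_ V H).hom ≫ antipodeAct φ) ≫ (α_ M H V).inv ≫
        (RightModObj.act : M ⊗ H ⟶ M) ▷ V := by
  have h₂ := hφ.mul_act
  have h := act_comp_coact_comp_braiding (H := H) M
  have hb := pushAct_comp_antipodeAct φ
  unfold coactAct
  set c := (LeftComodObj.coact : M ⟶ H ⊗ M)
  set a := (RightModObj.act : M ⊗ H ⟶ M)
  -- Associativity of the action, used twice, lets the three factors of S(h⁽³⁾)(m₍₋₁₎h⁽¹⁾) act one
  -- after another.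
  have h₃ : ((𝒮[H] ⊗ₘ μ[H]) ≫ μ[H]) ▷ V ≫ φ =
      𝟙 _ ⊗≫ H ◁ (H ◁ φ ≫ φ) ⊗≫ (𝒮[H] ▷ V ≫ φ) := by
    calc
      _ = (𝒮[H] ⊗ₘ μ[H]) ▷ V ≫ μ[H] ▷ V ≫ φ := by simp
      _ = 𝟙 _ ⊗≫ (𝒮[H] ▷ ((H ⊗ H) ⊗ V) ≫ H ◁ (μ[H] ▷ V ≫ φ)) ⊗≫ φ := by
        nth_rewrite 1 [h₂]
        rw [MonoidalCategory.tensorHom_def]; monoidal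
      _ = _ := by rw [h₂, ← whisker_exchange]; monoidal
  symm
  calc
    _ = 𝟙 _ ⊗≫ (M ◁ pushAct φ ≫ (c ≫ (β_ H M).hom) ▷ (V ⊗ H)) ⊗≫ M ◁ φ ▷ H ⊗≫
        M ◁ (β_ V H).hom ⊗≫ M ◁ antipodeAct φ ⊗≫ a ▷ V := by monoidal
    _ = 𝟙 _ ⊗≫ (c ≫ (β_ H M).hom) ▷ (H ⊗ V) ⊗≫ M ◁ (H ◁ pushAct φ ⊗≫ φ ▷ H ⊗≫
        (β_ V H).hom ⊗≫ antipodeAct φ) ⊗≫ a ▷ V := by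
      rw [whisker_exchange]; monoidal
    _ = 𝟙 _ ⊗≫ c ▷ (H ⊗ V) ⊗≫ ((β_ H M).hom ▷ H ≫ (M ⊗ H) ◁ (Δ[H] ≫ H ◁ Δ[H])) ▷ V ⊗≫
        M ◁ (β_ (H ⊗ H) (H ⊗ H)).hom ▷ V ⊗≫ ((M ⊗ H) ◁ (𝟙 ((H ⊗ H ⊗ H) ⊗ V) ⊗≫ H ◁ (H ◁ φ ≫ φ) ⊗≫
          (𝒮[H] ▷ V ≫ φ)) ≫ a ▷ V) := by
      rw [hb]; monoidal
    _ = 𝟙 _ ⊗≫ (c ▷ H ≫ (H ⊗ M) ◁ (Δ[H] ≫ H ◁ Δ[H])) ▷ V ⊗≫ (β_ H M).hom ▷ (H ⊗ H ⊗ H ⊗ V) ⊗≫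
        M ◁ (β_ (H ⊗ H) (H ⊗ H)).hom ▷ V ⊗≫ a ▷ ((H ⊗ H ⊗ H) ⊗ V) ⊗≫
          M ◁ (((𝒮[H] ⊗ₘ μ[H]) ≫ μ[H]) ▷ V ≫ φ) := by
      rw [← whisker_exchange (β_ H M).hom, whisker_exchange a, h₃]; monoidal
    _ = (a ≫ c ≫ (β_ H M).hom) ▷ V ⊗≫ M ◁ φ := by
      rw [h, MonoidalCategory.tensorHom_def c, MonoidalCategory.tensorHom_def a]; monoidal
    _ = _ := by monoidal

theorem rotate_eq_coactAct {V : 𝒞} (φ : H ⊗ V ⟶ V) (X : 𝒞) :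
    rotate M φ X = (α_ M V X).inv ≫ coactAct M φ ▷ X ≫ (α_ M V X).hom ≫ M ◁ (β_ V X).hom := by
  rw [rotate_eq, coactAct]
  monoidal

/-- `p` coequalizes the two actions of `H` on `M ⊗ W`. -/
def Balances {W Z : 𝒞} (φ : H ⊗ W ⟶ W) (p : M ⊗ W ⟶ Z) : Prop :=
  (RightModObj.act : M ⊗ H ⟶ M) ▷ W ≫ p = (α_ M H W).hom ≫ M ◁ φ ≫ p

variable {M}

theorem Balances.precomp {V W Z : 𝒞} {φ : H ⊗ V ⟶ V} {χ : H ⊗ W ⟶ W} {p : M ⊗ W ⟶ Z}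
    (hp : Balances M χ p) {f : V ⟶ W} (hf : Intertwines φ χ f) :
    Balances M φ (M ◁ f ≫ p) := by
  unfold Balances Intertwines at *
  rw [← whisker_exchange_assoc, hp, ← whiskerLeft_comp_assoc, hf]
  simp

/-- After `act_comp_coactAct`, balancedness of p moves h⁽²⁾ from M onto X ⊗ V, and
`antipodeAct_comp_tensorAct` cancels the antipode against the new leg acting on V. -/
theorem Balances.rotate {V X Z : 𝒞} {φ : H ⊗ V ⟶ V} (hφ : IsAction φ) {χ : H ⊗ X ⟶ X} {p : M ⊗ X ⊗ V ⟶ Z}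
    (hp : Balances M (tensorAct χ φ) p) :
    Balances M (tensorAct φ χ)
      (rotate M φ X ≫ p) := by
  have h := act_comp_coactAct M hφ
  have h₁ := antipodeAct_comp_tensorAct hφ χ
  unfold Balances at *
  rw [rotate_eq_coactAct, tensorAct_eq_pushAct φ χ]
  set a := (RightModObj.act : M ⊗ H ⟶ M)
  calc
    _ = 𝟙 _ ⊗≫ (a ▷ V ≫ coactAct M φ) ▷ X ⊗≫ M ◁ (β_ V X).hom ⊗≫ p := by monoidal
    _ = 𝟙 _ ⊗≫ M ◁ pushAct φ ▷ X ⊗≫ coactAct M φ ▷ (H ⊗ X) ⊗≫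
        M ◁ (β_ V H).hom ▷ X ⊗≫ M ◁ antipodeAct φ ▷ X ⊗≫
        (a ▷ (V ⊗ X) ≫ M ◁ (β_ V X).hom) ⊗≫ p := by
      rw [h]; monoidal
    _ = 𝟙 _ ⊗≫ M ◁ pushAct φ ▷ X ⊗≫ coactAct M φ ▷ (H ⊗ X) ⊗≫
        M ◁ (β_ V H).hom ▷ X ⊗≫ M ◁ antipodeAct φ ▷ X ⊗≫
        (M ⊗ H) ◁ (β_ V X).hom ⊗≫ (a ▷ (X ⊗ V) ≫ p) := by
      rw [← whisker_exchange a]; monoidal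
    _ = 𝟙 _ ⊗≫ M ◁ pushAct φ ▷ X ⊗≫ coactAct M φ ▷ (H ⊗ X) ⊗≫
        M ◁ ((β_ V H).hom ▷ X ≫ antipodeAct φ ▷ X ≫ (α_ H V X).hom ≫
        H ◁ (β_ V X).hom ≫ tensorAct χ φ) ⊗≫ p := by
      rw [hp]; monoidal
    _ = 𝟙 _ ⊗≫ M ◁ pushAct φ ▷ X ⊗≫ (coactAct M φ ▷ (H ⊗ X) ≫ (M ⊗ V) ◁ χ) ⊗≫
        M ◁ (β_ V X).hom ⊗≫ p := by
      rw [h₁]; monoidal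
    _ = _ := by rw [← whisker_exchange]; monoidal

/-- A balanced map moves m₍₋₁₎ back onto m₍₀₎, where stability gives m. -/
theorem Balances.coactAct_comp {V Z : 𝒞} {φ : H ⊗ V ⟶ V} {p : M ⊗ V ⟶ Z} (hp : Balances M φ p) :
    coactAct M φ ≫ p = p := by
  have h := SAYDObj.stable (H := H) (M := M)
  unfold Balances at hp
  unfold coactAct
  simp only [Category.assoc]
  rw [← hp, ← comp_whiskerRight_assoc, ← comp_whiskerRight_assoc, Category.assoc, h,
    id_whiskerRight, Category.id_comp]

end SAYD

/-! ### Coherence and cosimplicial identities on tensor powers -/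

section TensorPowerIdentities

variable {𝒞 : Type u} [Category.{v} 𝒞] [MonoidalCategory 𝒞] (C : 𝒞)

theorem tpowSnoc_zero_hom : (tpowSnoc C 0).hom = (λ_ C).hom ≫ (ρ_ C).inv := rfl

/-- The coherence isomorphism `A ^ k ⊗ A ^ l ⟶ A ^ N` for `k + l = N`. -/
def tpowAppend : ∀ k l N : ℕ, k + l = N → (tpow C k ⊗ tpow C l ⟶ tpow C N)
  -- With the exponent N of the target as a free variable, the successor clause recurses without
  -- casts; the transport here is an identity once N is l.
  | 0, l, N, h => (λ_ (tpow C l)).hom ≫ eqToHom (by rw [← h, Nat.zero_add])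
  | k + 1, l, 0, h => absurd h (by omega)
  | k + 1, l, N + 1, h =>
    (α_ C (tpow C k) (tpow C l)).hom ≫ C ◁ tpowAppend k l N (by omega)

theorem tpowAppend_zero_left (l : ℕ) (h : 0 + l = l) :
    tpowAppend C 0 l l h = (λ_ (tpow C l)).hom :=
  Category.comp_id _

theorem tpowAppend_succ_left (k l N : ℕ) (h : k + l = N) (h' : k + 1 + l = N + 1) :
    tpowAppend C (k + 1) l (N + 1) h' =
      (α_ C (tpow C k) (tpow C l)).hom ≫ C ◁ tpowAppend C k l N h := rfl

theorem tpowAppend_zero_right (k : ℕ) (h : k + 0 = k) :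
    tpowAppend C k 0 k h = (ρ_ (tpow C k)).hom := by
  induction k with
  | zero => rw [tpowAppend_zero_left]; exact unitors_equal
  | succ k ih =>
    rw [tpowAppend_succ_left C k 0 k rfl, ih]
    exact (rightUnitor_tensor_hom C (tpow C k)).symm

theorem tpowAppend_comp_tpowSnoc (k l N : ℕ) (h : k + l = N) (h' : k + (l + 1) = N + 1) :
    tpowAppend C k l N h ▷ C ≫ (tpowSnoc C N).hom =
      (α_ (tpow C k) (tpow C l) C).hom ≫ tpow C k ◁ (tpowSnoc C l).hom ≫
        tpowAppend C k (l + 1) (N + 1) h' := by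
  induction k generalizing N with
  | zero =>
    obtain rfl : l = N := by omega
    -- Stated for arbitrary objects, so that coherence is decided without unfolding `tpow`; the
    -- instance needed then matches by definition. The later `key` statements play the same role.
    have key {X Y : 𝒞} (f : X ⊗ C ⟶ Y) :
        (λ_ X).hom ▷ C ≫ f = (α_ (𝟙_ 𝒞) X C).hom ≫ 𝟙_ 𝒞 ◁ f ≫ (λ_ Y).hom := by simp
    rw [tpowAppend_zero_left, tpowAppend_zero_left]
    exact key _
  | succ k ih =>
    obtain ⟨N, rfl⟩ : ∃ N', N = N' + 1 := ⟨k + l, by omega⟩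
    have key {A B D E F : 𝒞} (f : A ⊗ B ⟶ D) (g : D ⊗ C ⟶ F) (s : B ⊗ C ⟶ E) (t : A ⊗ E ⟶ F)
        (hf : f ▷ C ≫ g = (α_ A B C).hom ≫ A ◁ s ≫ t) :
        ((α_ C A B).hom ≫ C ◁ f) ▷ C ≫ (α_ C D C).hom ≫ C ◁ g =
          (α_ (C ⊗ A) B C).hom ≫ (C ⊗ A) ◁ s ≫ (α_ C A E).hom ≫ C ◁ t := by
      calc
        _ = 𝟙 _ ⊗≫ C ◁ (f ▷ C ≫ g) := by monoidal
        _ = _ := by rw [hf]; monoidal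
    exact key _ _ _ _ (ih N (by omega) (by omega))

theorem tpowSnoc_comp_tpowAppend (k l N : ℕ) (h : k + 1 + l = N) (h' : k + (l + 1) = N) :
    (tpowSnoc C k).hom ▷ tpow C l ≫ tpowAppend C (k + 1) l N h =
      (α_ (tpow C k) C (tpow C l)).hom ≫ tpowAppend C k (l + 1) N h' := by
  induction k generalizing N with
  | zero =>
    obtain rfl : N = l + 1 := by omega
    have key (X : 𝒞) : ((λ_ C).hom ≫ (ρ_ C).inv) ▷ X ≫ (α_ C (𝟙_ 𝒞) X).hom ≫ C ◁ (λ_ X).hom =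
        (α_ (𝟙_ 𝒞) C X).hom ≫ (λ_ (C ⊗ X)).hom := by monoidal
    rw [tpowAppend_succ_left C 0 l l (by omega), tpowAppend_zero_left,
      tpowAppend_zero_left, tpowSnoc_zero_hom]
    exact key _
  | succ k ih =>
    obtain ⟨N, rfl⟩ : ∃ N', N = N' + 1 := ⟨k + 1 + l, by omega⟩
    have key {A B D E : 𝒞} (s : A ⊗ C ⟶ B) (f : B ⊗ D ⟶ E) (g : A ⊗ C ⊗ D ⟶ E)
        (hf : s ▷ D ≫ f = (α_ A C D).hom ≫ g) :
        ((α_ C A C).hom ≫ C ◁ s) ▷ D ≫ (α_ C B D).hom ≫ C ◁ f =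
          (α_ (C ⊗ A) C D).hom ≫ (α_ C A (C ⊗ D)).hom ≫ C ◁ g := by
      calc
        _ = 𝟙 _ ⊗≫ C ◁ (s ▷ D ≫ f) := by monoidal
        _ = _ := by rw [hf]; monoidal
    exact key _ _ _ (ih N (by omega) (by omega))

theorem whiskerLeft_comp_eq_of_comp_eq {X Y Y' Z : 𝒞} {f : X ⟶ Y} {g : Y ⟶ Z} {f' : X ⟶ Y'}
    {g' : Y' ⟶ Z} (h : f ≫ g = f' ≫ g') : C ◁ f ≫ C ◁ g = C ◁ f' ≫ C ◁ g' := by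
  rw [← whiskerLeft_comp, h, whiskerLeft_comp]

theorem whiskerLeft_comp_eq_id {X Y : 𝒞} {f : X ⟶ Y} {g : Y ⟶ X} (h : f ≫ g = 𝟙 X) :
    C ◁ f ≫ C ◁ g = 𝟙 (C ⊗ X) := by
  rw [← whiskerLeft_comp, h, whiskerLeft_id]

theorem whiskerRight_comp_of_whiskerLeft {A B D E : 𝒞} {f : A ⟶ B} {s : B ⊗ C ⟶ D} {t : A ⊗ C ⟶ E}
    {g : E ⟶ D} (h : f ▷ C ≫ s = t ≫ g) :
    (C ◁ f) ▷ C ≫ (α_ C B C).hom ≫ C ◁ s = ((α_ C A C).hom ≫ C ◁ t) ≫ C ◁ g := by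
  rw [associator_naturality_middle_assoc, ← whiskerLeft_comp, h, Category.assoc, whiskerLeft_comp]

variable [ComonObj C]

theorem counitAt_zero (n : ℕ) :
    counitAt C n 0 = ε[C] ▷ tpow C n ≫ (λ_ (tpow C n)).hom := by
  cases n <;> rfl

theorem counitAt_succ (n : ℕ) (i : Fin (n + 1)) :
    counitAt C (n + 1) i.succ = C ◁ counitAt C n i := rfl

theorem comul_whiskerRight_naturality {X Y : 𝒞} (f : X ⟶ Y) :
    (Δ[C] ▷ X ≫ (α_ C C X).hom) ≫ C ◁ C ◁ f = C ◁ f ≫ Δ[C] ▷ Y ≫ (α_ C C Y).hom := by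
  rw [Category.assoc, ← associator_naturality_right, whisker_exchange_assoc]

theorem counit_whiskerRight_naturality {X Y : 𝒞} (f : X ⟶ Y) :
    (ε[C] ▷ X ≫ (λ_ X).hom) ≫ f = C ◁ f ≫ ε[C] ▷ Y ≫ (λ_ Y).hom := by
  rw [Category.assoc, ← leftUnitor_naturality, whisker_exchange_assoc]

theorem comul_whiskerRight_assoc (X : 𝒞) :
    (Δ[C] ▷ X ≫ (α_ C C X).hom) ≫ C ◁ (Δ[C] ▷ X ≫ (α_ C C X).hom) =
      (Δ[C] ▷ X ≫ (α_ C C X).hom) ≫ Δ[C] ▷ (C ⊗ X) ≫ (α_ C C (C ⊗ X)).hom := by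
  calc
    _ = 𝟙 _ ⊗≫ (Δ[C] ≫ C ◁ Δ[C]) ▷ X ⊗≫ 𝟙 _ := by monoidal
    _ = _ := by rw [ComonObj.comul_assoc]; monoidal

theorem comul_counit_whiskerRight (X : 𝒞) :
    (Δ[C] ▷ X ≫ (α_ C C X).hom) ≫ ε[C] ▷ (C ⊗ X) ≫ (λ_ (C ⊗ X)).hom = 𝟙 (C ⊗ X) := by
  calc
    _ = 𝟙 _ ⊗≫ (Δ[C] ≫ ε[C] ▷ C) ▷ X ⊗≫ 𝟙 _ := by monoidal
    _ = _ := by rw [ComonObj.counit_comul]; monoidal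

theorem comul_whiskerLeft_counit (X : 𝒞) :
    (Δ[C] ▷ X ≫ (α_ C C X).hom) ≫ C ◁ (ε[C] ▷ X ≫ (λ_ X).hom) = 𝟙 (C ⊗ X) := by
  calc
    _ = 𝟙 _ ⊗≫ (Δ[C] ≫ C ◁ ε[C]) ▷ X ⊗≫ 𝟙 _ := by monoidal
    _ = _ := by rw [ComonObj.comul_counit]; monoidal

theorem comulAt_comp_comulAt (n : ℕ) (i j : Fin n) (hij : i ≤ j) :
    comulAt C n i ≫ comulAt C (n + 1) j.succ = comulAt C n j ≫ comulAt C (n + 1) i.castSucc := by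
  induction n with
  | zero => exact i.elim0
  | succ n ih =>
    induction i using Fin.cases with
    | zero =>
      induction j using Fin.cases with
      | zero => exact comul_whiskerRight_assoc C _
      | succ j => exact comul_whiskerRight_naturality C _
    | succ i =>
      induction j using Fin.cases with
      | zero => exact absurd hij (by simp)
      | succ j => exact whiskerLeft_comp_eq_of_comp_eq C (ih i j (by simpa using hij))

theorem counitAt_comp_counitAt (n : ℕ) (i j : Fin (n + 1)) (hij : i ≤ j) :
    counitAt C (n + 1) i.castSucc ≫ counitAt C n j =
      counitAt C (n + 1) j.succ ≫ counitAt C n i := by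
  induction n with
  | zero =>
    obtain rfl := Fin.fin_one_eq_zero i
    obtain rfl := Fin.fin_one_eq_zero j
    exact counit_whiskerRight_naturality C _
  | succ n ih =>
    induction i using Fin.cases with
    | zero => exact counit_whiskerRight_naturality C _
    | succ i =>
      induction j using Fin.cases with
      | zero => exact absurd hij (by simp)
      | succ j => exact whiskerLeft_comp_eq_of_comp_eq C (ih i j (by simpa using hij))

theorem comulAt_comp_counitAt_castSucc (n : ℕ) (i : Fin n) :
    comulAt C n i ≫ counitAt C n i.castSucc = 𝟙 _ := by
  induction n with
  | zero => exact i.elim0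
  | succ n ih =>
    induction i using Fin.cases with
    | zero => exact comul_counit_whiskerRight C _
    | succ i => exact whiskerLeft_comp_eq_id C (ih i)

theorem comulAt_comp_counitAt_succ (n : ℕ) (i : Fin n) :
    comulAt C n i ≫ counitAt C n i.succ = 𝟙 _ := by
  induction n with
  | zero => exact i.elim0
  | succ n ih =>
    rw [counitAt_succ]
    induction i using Fin.cases with
    | zero =>
      rw [counitAt_zero]
      exact comul_whiskerLeft_counit C _
    | succ i => exact whiskerLeft_comp_eq_id C (ih i)

theorem comulAt_comp_counitAt_of_lt (n : ℕ) (i : Fin n) (k : Fin (n + 1)) (h : i.castSucc < k) :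
    comulAt C (n + 1) i.castSucc ≫ counitAt C (n + 1) k.succ =
      counitAt C n k ≫ comulAt C n i := by
  induction n with
  | zero => exact i.elim0
  | succ n ih =>
    induction k using Fin.cases with
    | zero => exact absurd h (by simp)
    | succ k =>
      induction i using Fin.cases with
      | zero => exact comul_whiskerRight_naturality C _
      | succ i => exact whiskerLeft_comp_eq_of_comp_eq C (ih i k (by simpa using h))

theorem comulAt_comp_counitAt_of_ge (n : ℕ) (i : Fin n) (k : Fin (n + 1)) (h : k ≤ i.castSucc) :
    comulAt C (n + 1) i.succ ≫ counitAt C (n + 1) k.castSucc =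
      counitAt C n k ≫ comulAt C n i := by
  induction n with
  | zero => exact i.elim0
  | succ n ih =>
    induction k using Fin.cases with
    | zero => exact (counit_whiskerRight_naturality C _).symm
    | succ k =>
      induction i using Fin.cases with
      | zero => exact absurd h (by simp)
      | succ i => exact whiskerLeft_comp_eq_of_comp_eq C (ih i k (by simpa using h))

theorem comulAt_comp_tpowSnoc (n : ℕ) (i : Fin n) :
    comulAt C n i ▷ C ≫ (tpowSnoc C (n + 1)).hom =
      (tpowSnoc C n).hom ≫ comulAt C (n + 1) i.castSucc := by
  induction n with
  | zero => exact i.elim0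
  | succ n ih =>
    induction i using Fin.cases with
    | zero =>
      have key {A B : 𝒞} (s : A ⊗ C ⟶ B) :
          (Δ[C] ▷ A ≫ (α_ C C A).hom) ▷ C ≫ (α_ C (C ⊗ A) C).hom ≫
            C ◁ ((α_ C A C).hom ≫ C ◁ s) =
          ((α_ C A C).hom ≫ C ◁ s) ≫ Δ[C] ▷ B ≫ (α_ C C B).hom := by
        calc
          _ = 𝟙 _ ⊗≫ (Δ[C] ▷ (A ⊗ C) ≫ (C ⊗ C) ◁ s) ⊗≫ 𝟙 _ := by monoidal
          _ = _ := by rw [← whisker_exchange]; monoidal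
      exact key _
    | succ i => exact whiskerRight_comp_of_whiskerLeft C (ih i)

theorem comul_comp_tpowSnoc_last (n : ℕ) :
    tpow C n ◁ Δ[C] ≫ (α_ (tpow C n) C C).inv ≫ (tpowSnoc C n).hom ▷ C ≫
      (tpowSnoc C (n + 1)).hom = (tpowSnoc C n).hom ≫ comulAt C (n + 1) (Fin.last n) := by
  induction n with
  | zero =>
    have key : 𝟙_ 𝒞 ◁ Δ[C] ≫ (α_ (𝟙_ 𝒞) C C).inv ≫ ((λ_ C).hom ≫ (ρ_ C).inv) ▷ C ≫
        (α_ C (𝟙_ 𝒞) C).hom ≫ C ◁ ((λ_ C).hom ≫ (ρ_ C).inv) =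
        ((λ_ C).hom ≫ (ρ_ C).inv) ≫ Δ[C] ▷ 𝟙_ 𝒞 ≫ (α_ C C (𝟙_ 𝒞)).hom := by monoidal
    exact key
  | succ n ih =>
    have key {A B D : 𝒞} (s : A ⊗ C ⟶ B) (t : B ⊗ C ⟶ D) (g : B ⟶ D)
        (h : A ◁ Δ[C] ≫ (α_ A C C).inv ≫ s ▷ C ≫ t = s ≫ g) :
        (C ⊗ A) ◁ Δ[C] ≫ (α_ (C ⊗ A) C C).inv ≫ ((α_ C A C).hom ≫ C ◁ s) ▷ C ≫
          (α_ C B C).hom ≫ C ◁ t = ((α_ C A C).hom ≫ C ◁ s) ≫ C ◁ g := by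
      calc
        _ = 𝟙 _ ⊗≫ C ◁ (A ◁ Δ[C] ≫ (α_ A C C).inv ≫ s ▷ C ≫ t) := by monoidal
        _ = _ := by rw [h]; monoidal
    exact key _ _ _ ih

theorem counitAt_comp_tpowSnoc (n : ℕ) (i : Fin (n + 1)) :
    counitAt C n i ▷ C ≫ (tpowSnoc C n).hom =
      (tpowSnoc C (n + 1)).hom ≫ counitAt C (n + 1) i.castSucc := by
  have key {A B : 𝒞} (s : A ⊗ C ⟶ B) :
      (ε[C] ▷ A ≫ (λ_ A).hom) ▷ C ≫ s =
        ((α_ C A C).hom ≫ C ◁ s) ≫ ε[C] ▷ B ≫ (λ_ B).hom := by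
    rw [Category.assoc, ← counit_whiskerRight_naturality]
    monoidal
  induction n with
  | zero =>
    obtain rfl := Fin.fin_one_eq_zero i
    exact key _
  | succ n ih =>
    induction i using Fin.cases with
    | zero => exact key _
    | succ i => exact whiskerRight_comp_of_whiskerLeft C (ih i)

theorem counit_comp_tpowSnoc_last (n : ℕ) :
    tpow C n ◁ ε[C] ≫ (ρ_ (tpow C n)).hom = (tpowSnoc C n).hom ≫ counitAt C n (Fin.last n) := by
  induction n with
  | zero =>
    have key : 𝟙_ 𝒞 ◁ ε[C] ≫ (ρ_ (𝟙_ 𝒞)).hom =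
        ((λ_ C).hom ≫ (ρ_ C).inv) ≫ ε[C] ▷ 𝟙_ 𝒞 ≫ (λ_ (𝟙_ 𝒞)).hom := by monoidal
    exact key
  | succ n ih =>
    have key {A B : 𝒞} (s : A ⊗ C ⟶ B) (g : B ⟶ A) (h : A ◁ ε[C] ≫ (ρ_ A).hom = s ≫ g) :
        (C ⊗ A) ◁ ε[C] ≫ (ρ_ (C ⊗ A)).hom = ((α_ C A C).hom ≫ C ◁ s) ≫ C ◁ g := by
      rw [Category.assoc, ← whiskerLeft_comp, ← h]
      monoidal
    exact key _ _ ih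

end TensorPowerIdentities

/-! ### Relations involving the last coface -/

section Cocyclic

variable {𝒞 : Type u} [Category.{v} 𝒞]

/-- The relations involving the last coface follow from `δ_last = τ δ_0`, the relations between
the other cofaces and the codegeneracies, and the relations of these with the cyclic maps. -/
theorem CocyclicOperators.IsCocyclic.of_inner {X : ℕ → 𝒞} {D : CocyclicOperators X}
    (δ_comp_δ : ∀ (n : ℕ) (i j : Fin (n + 1)), i ≤ j →
      D.δ n i.castSucc ≫ D.δ (n + 1) j.succ.castSucc =
        D.δ n j.castSucc ≫ D.δ (n + 1) i.castSucc.castSucc)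
    (σ_comp_σ : ∀ (n : ℕ) (i j : Fin (n + 1)), i ≤ j →
      D.σ (n + 1) i.castSucc ≫ D.σ n j = D.σ (n + 1) j.succ ≫ D.σ n i)
    (δ_comp_σ_of_le : ∀ (n : ℕ) (i j : Fin (n + 1)), i ≤ j →
      D.δ (n + 1) i.castSucc.castSucc ≫ D.σ (n + 1) j.succ = D.σ n j ≫ D.δ n i.castSucc)
    (δ_comp_σ_self : ∀ (n : ℕ) (i : Fin (n + 1)), D.δ n i.castSucc ≫ D.σ n i = 𝟙 (X n))
    (δ_comp_σ_succ : ∀ (n : ℕ) (i : Fin n), D.δ n i.succ.castSucc ≫ D.σ n i.castSucc = 𝟙 (X n))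
    (δ_comp_σ_last : ∀ n : ℕ, D.δ n 0 ≫ D.τ (n + 1) ≫ D.σ n (Fin.last n) = 𝟙 (X n))
    (δ_comp_σ_of_gt : ∀ (n : ℕ) (i j : Fin (n + 1)), j < i →
      D.δ (n + 1) i.succ.castSucc ≫ D.σ (n + 1) j.castSucc = D.σ n j ≫ D.δ n i.castSucc)
    (δ_zero_comp_τ : ∀ n : ℕ, D.δ n 0 ≫ D.τ (n + 1) = D.δ n (Fin.last (n + 1)))
    (δ_succ_comp_τ : ∀ (n : ℕ) (i : Fin (n + 1)),
      D.δ n i.succ ≫ D.τ (n + 1) = D.τ n ≫ D.δ n i.castSucc)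
    (σ_zero_comp_τ : ∀ n : ℕ,
      D.σ n 0 ≫ D.τ n = D.τ (n + 1) ≫ D.τ (n + 1) ≫ D.σ n (Fin.last n))
    (σ_succ_comp_τ : ∀ (n : ℕ) (i : Fin n),
      D.σ n i.succ ≫ D.τ n = D.τ (n + 1) ≫ D.σ n i.castSucc)
    (τ_pow : ∀ n : ℕ, (End.of (D.τ n)) ^ (n + 1) = 1) :
    D.IsCocyclic where
  σ_comp_σ := σ_comp_σ
  δ_comp_σ_self := δ_comp_σ_self
  δ_zero_comp_τ := δ_zero_comp_τ
  δ_succ_comp_τ := δ_succ_comp_τ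
  σ_zero_comp_τ := σ_zero_comp_τ
  σ_succ_comp_τ := σ_succ_comp_τ
  τ_pow := τ_pow
  δ_comp_δ n i j hij := by
    induction j using Fin.lastCases with
    | last =>
      rw [Fin.succ_last, ← δ_zero_comp_τ]
      induction i using Fin.lastCases with
      | last =>
        -- Writing each last coface as δ_0 followed by τ and moving every τ to the end reduces the
        -- claim to δ_1 δ_0 = δ_0 δ_0.
        have h₁ := δ_succ_comp_τ (n + 1) (Fin.last (n + 1))
        have h₂ := δ_succ_comp_τ (n + 1) 0
        have h₃ := δ_comp_δ n 0 0 le_rfl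
        simp only [Fin.succ_last, Fin.castSucc_zero, Fin.succ_zero_eq_one, Fin.castSucc_one]
          at h₁ h₂ h₃
        rw [← δ_zero_comp_τ n, Category.assoc, Category.assoc, ← h₁, ← δ_zero_comp_τ (n + 1),
          ← reassoc_of% h₂, reassoc_of% h₃]
        simp only [Category.assoc]
      | cast i =>
        have h₁ := δ_succ_comp_τ (n + 1) i.castSucc
        have h₂ := δ_comp_δ n 0 i (Fin.zero_le _)
        simp only [Fin.castSucc_zero, ← Fin.succ_castSucc] at h₁ h₂
        rw [← δ_zero_comp_τ n, Category.assoc, ← h₁]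
        simp only [Fin.succ_castSucc] at h₂ ⊢
        rw [reassoc_of% h₂]
    | cast j =>
      induction i using Fin.lastCases with
      | last => exact absurd hij (by simp [Fin.le_def]; omega)
      | cast i =>
        rw [Fin.succ_castSucc]
        exact δ_comp_δ n i j (by simpa using hij)
  δ_comp_σ_of_le n i j hij := by
    induction i using Fin.lastCases with
    | last => exact absurd hij (by simp [Fin.le_def]; omega)
    | cast i => exact δ_comp_σ_of_le n i j (by simpa using hij)
  δ_comp_σ_succ n i := by
    induction i using Fin.lastCases with
    | last => rw [Fin.succ_last, ← δ_zero_comp_τ, Category.assoc, δ_comp_σ_last]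
    | cast i => rw [Fin.succ_castSucc, δ_comp_σ_succ]
  δ_comp_σ_of_gt n i j hij := by
    induction i using Fin.lastCases with
    | last =>
      have h₁ := σ_succ_comp_τ (n + 1) j
      have h₂ := δ_comp_σ_of_le n 0 j (Fin.zero_le _)
      simp only [Fin.castSucc_zero] at h₂
      rw [Fin.succ_last, ← δ_zero_comp_τ, ← δ_zero_comp_τ, Category.assoc, ← h₁, reassoc_of% h₂]
    | cast i =>
      rw [Fin.succ_castSucc]
      exact δ_comp_σ_of_gt n i j (by simpa using hij)

end Cocyclic

/-! ### The cyclic map and its powers -/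

section CyclicMap

variable {𝒞 : Type u} [Category.{v} 𝒞] [MonoidalCategory 𝒞] [SymmetricCategory 𝒞]
variable (H C M : 𝒞) [HopfObj H] [ModuleCoalgObj H C] [SAYDObj H M]

/-- The cyclic map of `M ⊗ C ^ (n + 1)`, as a rotation of tensor factors. -/
def cyclicMap (n : ℕ) : M ⊗ tpow C (n + 1) ⟶ M ⊗ tpow C (n + 1) :=
  rotate M (γ[H, C] : H ⊗ C ⟶ C) (tpow C n) ≫ M ◁ (tpowSnoc C n).hom

theorem operators_τ (n : ℕ) : (operators H C M).τ n = cyclicMap H C M n := by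
  have key {X Y : 𝒞} (s : X ⊗ C ⟶ Y) :
      (LeftComodObj.coact : M ⟶ H ⊗ M) ▷ (C ⊗ X) ≫ (β_ H M).hom ▷ (C ⊗ X) ≫
        (α_ M H (C ⊗ X)).hom ≫ M ◁ ((α_ H C X).inv ≫ (γ[H, C] : H ⊗ C ⟶ C) ▷ X ≫
          (β_ C X).hom ≫ s) = rotate M (γ[H, C] : H ⊗ C ⟶ C) X ≫ M ◁ s := by
    rw [rotate_eq]
    simp only [Category.assoc, whiskerLeft_comp]
  exact key _

theorem operators_δ_castSucc (n : ℕ) (i : Fin (n + 1)) :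
    (operators H C M).δ n i.castSucc = M ◁ comulAt C (n + 1) i := by
  simp only [operators, Fin.lastCases_castSucc]

theorem operators_δ_last (n : ℕ) :
    (operators H C M).δ n (Fin.last (n + 1)) =
      M ◁ comulAt C (n + 1) 0 ≫ cyclicMap H C M (n + 1) := by
  rw [← operators_τ]
  simp only [operators, Fin.lastCases_last]
  rw [MonoidalCategory.tensorHom_def', Category.assoc]

variable {M} in
theorem rotate_whiskerLeft_naturality {X Y X' Y' : 𝒞} {f : X ⟶ Y} {s : X ⊗ C ⟶ X'}
    {s' : Y ⊗ C ⟶ Y'} {g : X' ⟶ Y'} (h : f ▷ C ≫ s' = s ≫ g) :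
    M ◁ (C ◁ f) ≫ rotate M (γ[H, C] : H ⊗ C ⟶ C) Y ≫ M ◁ s' =
      (rotate M (γ[H, C] : H ⊗ C ⟶ C) X ≫ M ◁ s) ≫ M ◁ g := by
  rw [← Category.assoc, rotate_naturality_right, Category.assoc, Category.assoc,
    ← whiskerLeft_comp, ← whiskerLeft_comp, h]

theorem comulAt_succ_comp_cyclicMap (n : ℕ) (i : Fin n) :
    M ◁ comulAt C (n + 1) i.succ ≫ cyclicMap H C M (n + 1) =
      cyclicMap H C M n ≫ M ◁ comulAt C (n + 1) i.castSucc :=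
  rotate_whiskerLeft_naturality H C (comulAt_comp_tpowSnoc C n i)

theorem counitAt_succ_comp_cyclicMap (n : ℕ) (i : Fin (n + 1)) :
    M ◁ counitAt C (n + 1) i.succ ≫ cyclicMap H C M n =
      cyclicMap H C M (n + 1) ≫ M ◁ counitAt C (n + 1) i.castSucc :=
  rotate_whiskerLeft_naturality H C (counitAt_comp_tpowSnoc C n i)

/-- By `rotate_tensorAct`, the two rotations move both halves of the comultiplied factor as one
block C ⊗ C. Since Δ_C is H-linear, it may be applied after rotating instead. -/
theorem comulAt_zero_comp_cyclicMap_comp_cyclicMap (n : ℕ) :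
    (M ◁ comulAt C (n + 1) 0 ≫ cyclicMap H C M (n + 1)) ≫ cyclicMap H C M (n + 1) =
      cyclicMap H C M n ≫ M ◁ comulAt C (n + 1) (Fin.last n) := by
  have key {X B D : 𝒞} (s : X ⊗ C ⟶ B) (t : B ⊗ C ⟶ D) (g : B ⟶ D)
      (h : X ◁ Δ[C] ≫ (α_ X C C).inv ≫ s ▷ C ≫ t = s ≫ g) :
      (M ◁ (Δ[C] ▷ X ≫ (α_ C C X).hom) ≫ rotate M (γ[H, C] : H ⊗ C ⟶ C) (C ⊗ X) ≫
        M ◁ ((α_ C X C).hom ≫ C ◁ s)) ≫ rotate M (γ[H, C] : H ⊗ C ⟶ C) B ≫ M ◁ t =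
      (rotate M (γ[H, C] : H ⊗ C ⟶ C) X ≫ M ◁ s) ≫ M ◁ g := by
    have h₁ := rotate_naturality_right M (γ[H, C] : H ⊗ C ⟶ C) s
    have h₂ := rotate_naturality_left M (intertwines_comul H C) X
    have h₃ := rotate_tensorAct M (γ[H, C] : H ⊗ C ⟶ C) (γ[H, C] : H ⊗ C ⟶ C) X
    rw [Category.assoc (rotate M _ X), ← whiskerLeft_comp, ← h, whiskerLeft_comp M (X ◁ Δ[C]),
      ← reassoc_of% h₂, h₃]
    simp only [Category.assoc, whiskerLeft_comp, reassoc_of% h₁]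
    simp
  exact key _ _ _ (comul_comp_tpowSnoc_last C n)

/-- Since ε_C is H-linear, the rotated factor may be evaluated beforehand. The counit on factor 0 is
not among the σ_i; it is the extra codegeneracy, and this produces it from τ and the last counit. -/
theorem cyclicMap_comp_counitAt_last (n : ℕ) :
    cyclicMap H C M n ≫ M ◁ counitAt C n (Fin.last n) = M ◁ counitAt C n 0 := by
  have key {X B : 𝒞} (s : X ⊗ C ⟶ B) (g : B ⟶ X) (h : X ◁ ε[C] ≫ (ρ_ X).hom = s ≫ g) :
      (rotate M (γ[H, C] : H ⊗ C ⟶ C) X ≫ M ◁ s) ≫ M ◁ g =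
        M ◁ (ε[C] ▷ X ≫ (λ_ X).hom) := by
    have h₂ := rotate_naturality_left M (intertwines_counit H C) X
    rw [Category.assoc, ← whiskerLeft_comp, ← h, whiskerLeft_comp, ← reassoc_of% h₂,
      rotate_unitAct, ← whiskerLeft_comp]
    simp
  rw [counitAt_zero]
  exact key _ _ (counit_comp_tpowSnoc_last C n)

/-- Induction on the length of the rotated block: one τ rotates the first factor, τ^k the other k,
and `rotate_tensorAct` combines the two. -/
theorem tpowAppend_comp_cyclicMap_pow (n k l : ℕ) (h : k + l = n + 1) (h' : l + k = n + 1) :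
    M ◁ tpowAppend C k l (n + 1) h ≫ ((End.of (cyclicMap H C M n)) ^ k : End _) =
      rotate M (diagAct H C k) (tpow C l) ≫ M ◁ tpowAppend C l k (n + 1) h' := by
  induction k generalizing l with
  | zero =>
    obtain rfl : l = n + 1 := by omega
    have key (X : 𝒞) : M ◁ (λ_ X).hom ≫ 𝟙 _ = rotate M (unitAct H) X ≫ M ◁ (ρ_ X).hom := by
      rw [rotate_unitAct, ← whiskerLeft_comp]
      simp
    rw [tpowAppend_zero_left, tpowAppend_zero_right, diagAct_zero, pow_zero]
    exact key _
  | succ k ih =>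
    have key {A L N N' L' : 𝒞} (φ : H ⊗ A ⟶ A) (e : A ⊗ L ⟶ N') (sN : N' ⊗ C ⟶ N)
        (sL : L ⊗ C ⟶ L') (e₁ : A ⊗ L' ⟶ N) (e₂ : L' ⊗ A ⟶ N) (e₃ : L ⊗ (C ⊗ A) ⟶ N)
        (P : M ⊗ N ⟶ M ⊗ N)
        (h₁ : e ▷ C ≫ sN = (α_ A L C).hom ≫ A ◁ sL ≫ e₁)
        (h₂ : M ◁ e₁ ≫ P = rotate M φ L' ≫ M ◁ e₂)
        (h₃ : sL ▷ A ≫ e₂ = (α_ L C A).hom ≫ e₃) :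
        M ◁ ((α_ C A L).hom ≫ C ◁ e) ≫ (rotate M (γ[H, C] : H ⊗ C ⟶ C) N' ≫ M ◁ sN) ≫ P =
          rotate M (tensorAct (γ[H, C] : H ⊗ C ⟶ C) φ) L ≫ M ◁ e₃ := by
      have h₄ := rotate_naturality_right M (γ[H, C] : H ⊗ C ⟶ C) e
      have h₅ := rotate_naturality_right M φ sL
      rw [rotate_tensorAct]
      simp only [whiskerLeft_comp, Category.assoc]
      rw [reassoc_of% h₄, ← whiskerLeft_comp_assoc M (e ▷ C), h₁]
      simp only [whiskerLeft_comp, Category.assoc]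
      rw [h₂, reassoc_of% h₅, ← whiskerLeft_comp M (sL ▷ A), h₃, whiskerLeft_comp]
    -- Multiplication in `End` is composition in reverse order, so the split-off τ is applied before
    -- τ^k.
    rw [pow_succ, diagAct_succ]
    exact key _ _ _ _ _ _ _ _ (tpowAppend_comp_tpowSnoc C k l n (by omega) (by omega))
      (ih (l + 1) (by omega) (by omega))
      (tpowSnoc_comp_tpowAppend C l k (n + 1) (by omega) (by omega))

theorem cyclicMap_pow (n : ℕ) :
    ((End.of (cyclicMap H C M n)) ^ (n + 1) : End _) = coactAct M (diagAct H C (n + 1)) := by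
  have key {V : 𝒞} (φ : H ⊗ V ⟶ V) :
      rotate M φ (𝟙_ 𝒞) ≫ M ◁ (λ_ V).hom = M ◁ (ρ_ V).hom ≫ coactAct M φ := by
    rw [rotate_eq_coactAct, braiding_tensorUnit_right]
    monoidal
  have h := tpowAppend_comp_cyclicMap_pow H C M n (n + 1) 0 rfl (by omega)
  rw [tpowAppend_zero_left, tpowAppend_zero_right] at h
  rw [← cancel_epi (M ◁ (ρ_ (tpow C (n + 1))).hom)]
  exact h.trans (key _)

end CyclicMap

/-! ### Descent to the balanced tensor product -/

section Descent

variable {𝒞 : Type u} [Category.{v} 𝒞] [MonoidalCategory 𝒞] [SymmetricCategory 𝒞] [Abelian 𝒞]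
variable (H C M : 𝒞) [HopfObj H] [ModuleCoalgObj H C] [SAYDObj H M]

instance epi_balancedπ (n : ℕ) : Epi (balancedπ H C M n) :=
  inferInstanceAs (Epi (cokernel.π _))

/-- The difference is taken between morphisms out of (M ⊗ H) ⊗ C^{n+1}, so only additivity of
composition enters, not of ⊗. -/
theorem balances_balancedπ (n : ℕ) : Balances M (diagAct H C (n + 1)) (balancedπ H C M n) := by
  have h := cokernel.condition
    (balancingMap (RightModObj.act : M ⊗ H ⟶ M) (diagAct H C (n + 1)))
  rw [balancingMap, Preadditive.sub_comp, sub_eq_zero, Category.assoc] at h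
  exact h

theorem balances_cyclicMap (n : ℕ) :
    Balances M (diagAct H C (n + 1)) (cyclicMap H C M n ≫ balancedπ H C M n) := by
  have h := ((balances_balancedπ H C M n).precomp (intertwines_tpowSnoc H C n)).rotate
    isAction_smul
  rw [← diagAct_succ, ← Category.assoc] at h
  exact h

variable {H C M} in
/-- The map out of `M ⊗_H C ^ (n + 1)` induced by a balanced map. -/
def balancedDesc {n : ℕ} {Z : 𝒞} (f : M ⊗ tpow C (n + 1) ⟶ Z)
    (hf : Balances M (diagAct H C (n + 1)) f) : balanced H C M n ⟶ Z :=
  cokernel.desc _ f (by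
    rw [balancingMap, Preadditive.sub_comp, sub_eq_zero, Category.assoc]
    exact hf)

variable {H C M} in
theorem balancedπ_comp_balancedDesc {n : ℕ} {Z : 𝒞} (f : M ⊗ tpow C (n + 1) ⟶ Z)
    (hf : Balances M (diagAct H C (n + 1)) f) : balancedπ H C M n ≫ balancedDesc f hf = f :=
  cokernel.π_desc _ _ _

theorem balances_operators_δ (n : ℕ) (i : Fin (n + 2)) :
    Balances M (diagAct H C (n + 1)) ((operators H C M).δ n i ≫ balancedπ H C M (n + 1)) := by
  induction i using Fin.lastCases with
  | last =>
    rw [operators_δ_last, Category.assoc]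
    exact (balances_cyclicMap H C M (n + 1)).precomp (intertwines_comulAt H C (n + 1) 0)
  | cast i =>
    rw [operators_δ_castSucc]
    exact (balances_balancedπ H C M (n + 1)).precomp (intertwines_comulAt H C (n + 1) i)

theorem balances_operators_σ (n : ℕ) (i : Fin (n + 1)) :
    Balances M (diagAct H C (n + 2)) ((operators H C M).σ n i ≫ balancedπ H C M n) :=
  (balances_balancedπ H C M n).precomp (intertwines_counitAt H C (n + 1) i.succ)

theorem balances_operators_τ (n : ℕ) :
    Balances M (diagAct H C (n + 1)) ((operators H C M).τ n ≫ balancedπ H C M n) := by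
  rw [operators_τ]
  exact balances_cyclicMap H C M n

/-- The operators on `M ⊗_H C ^ (n + 1)` induced by those on `M ⊗ C ^ (n + 1)`. -/
def balancedOperators : CocyclicOperators (balanced H C M) where
  δ n i := balancedDesc _ (balances_operators_δ H C M n i)
  σ n i := balancedDesc _ (balances_operators_σ H C M n i)
  τ n := balancedDesc _ (balances_operators_τ H C M n)

theorem isInduced_balancedOperators : IsInduced H C M (balancedOperators H C M) where
  δ n i := balancedπ_comp_balancedDesc _ (balances_operators_δ H C M n i)
  σ n i := balancedπ_comp_balancedDesc _ (balances_operators_σ H C M n i)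
  τ n := balancedπ_comp_balancedDesc _ (balances_operators_τ H C M n)

variable {H C M}

theorem IsInduced.unique {D E : CocyclicOperators (balanced H C M)} (hD : IsInduced H C M D)
    (hE : IsInduced H C M E) : D = E := by
  ext n
  · rw [← cancel_epi (balancedπ H C M n), hD.δ, hE.δ]
  · rw [← cancel_epi (balancedπ H C M (n + 1)), hD.σ, hE.σ]
  · rw [← cancel_epi (balancedπ H C M n), hD.τ, hE.τ]

theorem IsInduced.isCocyclic {D : CocyclicOperators (balanced H C M)} (hD : IsInduced H C M D) :
    D.IsCocyclic := by
  have hδ (n : ℕ) (i : Fin (n + 1)) : balancedπ H C M n ≫ D.δ n i.castSucc =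
      M ◁ comulAt C (n + 1) i ≫ balancedπ H C M (n + 1) := by
    rw [hD.δ, operators_δ_castSucc]
  have hδ₀ (n : ℕ) : balancedπ H C M n ≫ D.δ n 0 =
      M ◁ comulAt C (n + 1) 0 ≫ balancedπ H C M (n + 1) := hδ n 0
  have hδl (n : ℕ) : balancedπ H C M n ≫ D.δ n (Fin.last (n + 1)) =
      (M ◁ comulAt C (n + 1) 0 ≫ cyclicMap H C M (n + 1)) ≫ balancedπ H C M (n + 1) := by
    rw [hD.δ, operators_δ_last]
  -- σ_i evaluates the factor numbered i + 1, which is why the counit identities below are used at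
  -- successor indices.
  have hσ (n : ℕ) (i : Fin (n + 1)) : balancedπ H C M (n + 1) ≫ D.σ n i =
      M ◁ counitAt C (n + 1) i.succ ≫ balancedπ H C M n := hD.σ n i
  have hτ (n : ℕ) : balancedπ H C M n ≫ D.τ n = cyclicMap H C M n ≫ balancedπ H C M n := by
    rw [hD.τ, operators_τ]
  refine .of_inner ?_ ?_ ?_ ?_ ?_ ?_ ?_ ?_ ?_ ?_ ?_ ?_
  · intro n i j hij
    rw [← cancel_epi (balancedπ H C M n), reassoc_of% hδ n i, reassoc_of% hδ n j, hδ, hδ,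
      ← whiskerLeft_comp_assoc, ← whiskerLeft_comp_assoc, comulAt_comp_comulAt C _ i j hij]
  · intro n i j hij
    rw [← cancel_epi (balancedπ H C M (n + 2)), reassoc_of% hσ (n + 1) i.castSucc,
      reassoc_of% hσ (n + 1) j.succ, hσ, hσ, ← whiskerLeft_comp_assoc, ← whiskerLeft_comp_assoc,
      Fin.succ_castSucc, counitAt_comp_counitAt C _ i.succ j.succ (by simpa using hij)]
  · intro n i j hij
    rw [← cancel_epi (balancedπ H C M (n + 1)), reassoc_of% hδ (n + 1), reassoc_of% hσ n, hσ, hδ,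
      ← whiskerLeft_comp_assoc, ← whiskerLeft_comp_assoc,
      comulAt_comp_counitAt_of_lt C _ i j.succ (by simpa [Fin.lt_def, Nat.lt_succ_iff] using hij)]
  · intro n i
    rw [← cancel_epi (balancedπ H C M n), reassoc_of% hδ n, hσ, ← whiskerLeft_comp_assoc,
      comulAt_comp_counitAt_succ]
    simp
  · intro n i
    rw [← cancel_epi (balancedπ H C M n), reassoc_of% hδ n, hσ, ← whiskerLeft_comp_assoc,
      Fin.succ_castSucc, comulAt_comp_counitAt_castSucc]
    simp
  · intro n
    rw [← cancel_epi (balancedπ H C M n), reassoc_of% hδ₀ n, reassoc_of% hτ (n + 1), hσ,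
      Fin.succ_last, reassoc_of% cyclicMap_comp_counitAt_last H C M (n + 1),
      ← whiskerLeft_comp_assoc,
      show comulAt C (n + 1) 0 ≫ counitAt C (n + 1) 0 = 𝟙 _ from
        comulAt_comp_counitAt_castSucc C (n + 1) 0]
    simp
  · intro n i j hij
    rw [← cancel_epi (balancedπ H C M (n + 1)), reassoc_of% hδ (n + 1), reassoc_of% hσ n, hσ, hδ,
      ← whiskerLeft_comp_assoc, ← whiskerLeft_comp_assoc, Fin.succ_castSucc,
      comulAt_comp_counitAt_of_ge C _ i j.succ (Fin.le_def.2 (Nat.succ_le_of_lt hij))]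
  · intro n
    rw [← cancel_epi (balancedπ H C M n), reassoc_of% hδ₀ n, hτ, hδl, Category.assoc]
  · intro n i
    rw [← cancel_epi (balancedπ H C M n), reassoc_of% hτ n, hδ]
    induction i using Fin.lastCases with
    | last =>
      rw [Fin.succ_last, reassoc_of% hδl n, hτ]
      simpa only [Category.assoc] using
        congrArg (· ≫ balancedπ H C M (n + 1)) (comulAt_zero_comp_cyclicMap_comp_cyclicMap H C M n)
    | cast i =>
      rw [Fin.succ_castSucc, reassoc_of% hδ n, hτ,
        reassoc_of% comulAt_succ_comp_cyclicMap H C M n i]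
  · intro n
    -- Passing σ_0 through τ gives the counit on factor 0, which is a further τ followed by the last
    -- counit; hence the square of τ.
    have h := counitAt_succ_comp_cyclicMap H C M n 0
    rw [Fin.castSucc_zero, ← cyclicMap_comp_counitAt_last] at h
    rw [← cancel_epi (balancedπ H C M (n + 1)), reassoc_of% hσ n, hτ, reassoc_of% hτ (n + 1),
      reassoc_of% hτ (n + 1), hσ, Fin.succ_last, reassoc_of% h]
  · intro n i
    rw [← cancel_epi (balancedπ H C M (n + 1)), reassoc_of% hσ n, hτ, reassoc_of% hτ (n + 1), hσ,
      reassoc_of% counitAt_succ_comp_cyclicMap H C M n i.succ, Fin.succ_castSucc]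
  · intro n
    have hp (k : ℕ) : balancedπ H C M n ≫ ((End.of (D.τ n)) ^ k : End _) =
        ((End.of (cyclicMap H C M n)) ^ k : End _) ≫ balancedπ H C M n := by
      induction k with
      | zero => exact (Category.comp_id _).trans (Category.id_comp _).symm
      | succ k ih =>
        rw [pow_succ, pow_succ, End.mul_def, End.mul_def, Category.assoc, ← ih]
        exact (reassoc_of% hτ n) _
    -- The one relation that needs the quotient: by stability, the projection absorbs `coactAct`.
    rw [← cancel_epi (balancedπ H C M n), hp, cyclicMap_pow,
      (balances_balancedπ H C M n).coactAct_comp]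
    exact (Category.comp_id _).symm

end Descent

end BraidedHopfCyclic

end

theorem mainTheorem1 {𝒞 : Type u} [Category.{v} 𝒞] [MonoidalCategory 𝒞] [SymmetricCategory 𝒞]
    [Abelian 𝒞] (H C M : 𝒞) [HopfObj H] [BraidedHopfCyclic.ModuleCoalgObj H C]
    [BraidedHopfCyclic.SAYDObj H M] :
    (∃! D : BraidedHopfCyclic.CocyclicOperators (BraidedHopfCyclic.balanced H C M),
      BraidedHopfCyclic.IsInduced H C M D) ∧
    ∀ D : BraidedHopfCyclic.CocyclicOperators (BraidedHopfCyclic.balanced H C M),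
      BraidedHopfCyclic.IsInduced H C M D → D.IsCocyclic :=
  ⟨⟨_, BraidedHopfCyclic.isInduced_balancedOperators H C M,
    fun _ hD => hD.unique (BraidedHopfCyclic.isInduced_balancedOperators H C M)⟩,
    fun _ hD => hD.isCocyclic⟩
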